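/- A Steiner triple system STS$(v)$ is a pair $(V,\mathcal B)$ with $|V|=v$ and $\mathcal B$ a collection of 3-subsets (triples) of $V$ such that every 2-subset of $V$ lies in exactly one triple. A (strict) $k$-bicoloring of it is a surjective map $\phi$ from $V$ onto a set of $k$ colors such that every triple receives exactly two colors. Given an STS$(v)$ $(V,\mathcal B)$, a set $X$ disjoint from $V$ with $|X|=v+1$, and a 1-factorization $\{F_a : a\in V\}$ of the complete graph on $X$, the doubling construction yields the STS$(2v+1)$ on $V\cup X$ whose triples are those of $\mathcal B$ together with all $\{a,x,y\}$ with $a\in V$ and $\{x,y\}\in F_a$. An extended $k$-bicoloring of order $w=2v+1$ is a $k$-bicoloring of an STS$(w)$ obtained by a doubling construction from some STS$(v)$ $(V,\mathcal B)$, whose restriction to $V$ is a $k$-bicoloring of $(V,\mathcal B)$ with the same $k$ colors. Theorem. There exists an extended $4$-bicoloring of order $w$ for each $w\in\{127,151,159,175\}$, and there exists an extended $5$-bicoloring of order $w$ for each $w\in\{103,111,127,135,151,159,175\}$. -/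

import Mathlib

/-- `B`, a family of subsets of `V` (the triples), is a Steiner triple system on `V`: every member
of `B` has exactly three points, and any two distinct points lie together in exactly one member. -/
structure IsSteinerTripleSystem {V : Type} (B : Set (Set V)) : Prop where
  card_eq_three : ∀ T ∈ B, T.ncard = 3
  existsUnique_triple : ∀ x y : V, x ≠ y → ∃! T : Set V, T ∈ B ∧ x ∈ T ∧ y ∈ T

/-- `φ` is a strict bicoloring of the triple system `B` with colour set `C`: every triple receives
exactly two colours, and every colour of `C` is used. -/
structure IsStrictBicoloring {V C : Type} (B : Set (Set V)) (φ : V → C) : Prop where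
  two_colors : ∀ T ∈ B, (φ '' T).ncard = 2
  surjective : Function.Surjective φ

/-- The family `F`, indexed by `V`, is a 1-factorization of the complete graph on `X`: each `F a`
is a perfect matching (1-factor), and each edge of the complete graph lies in exactly one `F a`. -/
structure IsOneFactorization {V X : Type} (F : V → (⊤ : SimpleGraph X).Subgraph) : Prop where
  perfect : ∀ a, (F a).IsPerfectMatching
  existsUnique_factor : ∀ x y : X, x ≠ y → ∃! a : V, (F a).Adj x y

/-- The doubling construction: on the disjoint union of `V` and `X`, take all triples of `B`,
together with all triples `{a, x, y}` where `a ∈ V` and `{x, y}` is an edge of `F a`. -/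
def doubling {V X : Type} (B : Set (Set V)) (F : V → (⊤ : SimpleGraph X).Subgraph) :
    Set (Set (V ⊕ X)) :=
  {T | ∃ S ∈ B, T = Sum.inl '' S} ∪
    {T | ∃ (a : V) (x y : X), (F a).Adj x y ∧ T = {Sum.inl a, Sum.inr x, Sum.inr y}}

/-- There is an extended `k`-bicoloring of order `w`: an STS(`v`) `B` on `V` with a strict
`k`-bicoloring `φ`, and an STS(`w`), `w = 2v + 1`, obtained from `B` by a doubling construction,
with a strict `k`-bicoloring `ψ` in the same `k` colours that agrees with `φ` on `V`. -/
def ExistsExtendedBicoloring (k w : ℕ) : Prop :=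
  ∃ (V X : Type) (_ : Finite V) (_ : Finite X)
    (B : Set (Set V)) (F : V → (⊤ : SimpleGraph X).Subgraph)
    (φ : V → Fin k) (ψ : V ⊕ X → Fin k),
    Nat.card X = Nat.card V + 1 ∧ w = 2 * Nat.card V + 1 ∧
    IsSteinerTripleSystem B ∧ IsOneFactorization F ∧
    IsSteinerTripleSystem (doubling B F) ∧
    IsStrictBicoloring B φ ∧ IsStrictBicoloring (doubling B F) ψ ∧
    ∀ a : V, ψ (Sum.inl a) = φ a

/-! Write v = 2n + 1 with n odd, and suppose that an STS(v) has a strict k-bicoloring in which two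
classes c and d together have n + 1 points, about half of V. Take X to be two copies of an (n +
1)-set Y, one coloured entirely c and the other entirely d. The edges between the copies form a
complete bipartite graph, which splits into n + 1 perfect matchings; index these by the n + 1 points
of colour c or d. Each new triple arising this way has colour set {c, d}. Since n + 1 is even, the
complete graph on Y has a 1-factorization with n factors; use it in both copies at once and index
its factors by the n remaining points. Such a triple has two points of one colour, c or d, and a
third point of a colour outside {c, d}. So every new triple has exactly two colours and the
bicoloring extends. This is `existsExtendedBicoloring_of_twoClasses`.

What remains is to exhibit, for each v = (w - 1) / 2, one bicoloured STS(v) whose first two class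
sizes add up to n + 1. Every triple of a bicoloured system has exactly one monochromatic pair, so
the sizes s must also satisfy ∑ s(s - 1)/2 = v(v - 1)/6. The eleven systems are given explicitly as
lists of third points and checked by evaluation; `existsExtendedBicoloring_of_table` turns a
successful check into an extended bicoloring. -/

/-! ### Steiner triple systems from third-point operations. -/

/-- `op` sends two distinct points to the third point of the triple through them. -/
structure IsThirdPoint {V : Type} (op : V → V → V) : Prop where
  ne_left : ∀ x y, x ≠ y → op x y ≠ x
  comm : ∀ x y, x ≠ y → op y x = op x y
  left_cancel : ∀ x y, x ≠ y → op x (op x y) = y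

/-- The triples `{x, y, op x y}`. -/
def triplesOf {V : Type} (op : V → V → V) : Set (Set V) :=
  {T | ∃ x y, x ≠ y ∧ T = {x, y, op x y}}

namespace IsThirdPoint

variable {V : Type} {op : V → V → V}

theorem ne_right (h : IsThirdPoint op) {x y : V} (hxy : x ≠ y) : op x y ≠ y :=
  h.comm x y hxy ▸ h.ne_left y x hxy.symm

theorem right_cancel (h : IsThirdPoint op) {x y : V} (hxy : x ≠ y) : op y (op x y) = x := by
  rw [← h.comm x y hxy]
  exact h.left_cancel y x hxy.symm

/-- This gives uniqueness of the triple through two points: `op` applied to any two of the points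
`a`, `b`, `op a b` returns the remaining one, so each pair in a triple generates the whole triple.
-/
theorem triple_eq (h : IsThirdPoint op) {a b x y : V} (hab : a ≠ b) (hxy : x ≠ y)
    (hx : x ∈ ({a, b, op a b} : Set V)) (hy : y ∈ ({a, b, op a b} : Set V)) :
    ({a, b, op a b} : Set V) = {x, y, op x y} := by
  -- These five equations evaluate `op` at the ordered pairs of points of the triple other than `(a,
  -- b)`; `h4` and `h5` reduce to `h2` and `h3`.
  have h1 := h.comm a b hab
  have h2 := h.left_cancel a b hab
  have h3 := h.right_cancel hab
  have h4 := h.comm a (op a b) (h.ne_left a b hab).symm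
  have h5 := h.comm b (op a b) (h.ne_right hab).symm
  simp only [Set.mem_insert_iff, Set.mem_singleton_iff] at hx hy
  rcases hx with rfl | rfl | rfl <;> rcases hy with rfl | rfl | rfl <;>
    first
    | exact absurd rfl hxy
    | (ext z
       simp only [Set.mem_insert_iff, Set.mem_singleton_iff, h1, h2, h3, h4, h5] <;> tauto)

theorem isSteinerTripleSystem (h : IsThirdPoint op) : IsSteinerTripleSystem (triplesOf op) where
  card_eq_three := by
    rintro T ⟨x, y, hxy, rfl⟩
    exact Set.ncard_eq_three.2
      ⟨x, y, op x y, hxy, (h.ne_left x y hxy).symm, (h.ne_right hxy).symm, rfl⟩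
  existsUnique_triple := by
    intro x y hxy
    refine ⟨{x, y, op x y}, ⟨⟨x, y, hxy, rfl⟩, by simp, by simp⟩, ?_⟩
    rintro T ⟨⟨a, b, hab, rfl⟩, hx, hy⟩
    exact h.triple_eq hab hxy hx hy

end IsThirdPoint

/-! ### One-factorizations and the doubling construction. -/

/-- The factors of the edge colouring `f` of the complete graph on `X`. -/
def factor {V X : Type} (f : X → X → V) (hf : ∀ x y, f x y = f y x) (a : V) :
    (⊤ : SimpleGraph X).Subgraph where
  verts := Set.univ
  Adj x y := x ≠ y ∧ f x y = a
  adj_sub h := h.1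
  edge_vert _ := Set.mem_univ _
  symm := ⟨fun _ _ h => ⟨h.1.symm, (hf _ _).trans h.2⟩⟩

/-- If every colour occurs exactly once at every vertex, the colour classes are perfect matchings,
and an edge lies only in the class of its own colour. Values of `f` on the diagonal play no role. -/
theorem isOneFactorization_factor {V X : Type} (f : X → X → V) (hf : ∀ x y, f x y = f y x)
    (h : ∀ a x, ∃! y, x ≠ y ∧ f x y = a) : IsOneFactorization (factor f hf) where
  perfect a := SimpleGraph.Subgraph.isPerfectMatching_iff.2 fun x => h a x
  existsUnique_factor x y hxy := ⟨f x y, ⟨hxy, rfl⟩, fun _ hb => hb.2.symm⟩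

/-- A pair inside `V` can only lie in an old triple, since a new one has a single point in `V`. A
pair `a`, `x` across is completed by the partner of `x` in `F a`. A pair inside `X` is completed by
the index of the one factor containing it. -/
theorem IsSteinerTripleSystem.doubling {V X : Type} {B : Set (Set V)}
    {F : V → (⊤ : SimpleGraph X).Subgraph} (hB : IsSteinerTripleSystem B)
    (hF : IsOneFactorization F) : IsSteinerTripleSystem (doubling B F) where
  card_eq_three := by
    rintro T (⟨S, hS, rfl⟩ | ⟨a, x, y, hxy, rfl⟩)
    · rw [Set.ncard_image_of_injective _ Sum.inl_injective]
      exact hB.card_eq_three S hS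
    · have hne : x ≠ y := hxy.ne
      exact Set.ncard_eq_three.2 ⟨_, _, _, by simp, by simp, by simpa using hne, rfl⟩
  existsUnique_triple := by
    -- Pairs with one point on each side, settled once for both orders of the pair.
    have mixed : ∀ (a : V) (x : X), ∃! T : Set (V ⊕ X),
        T ∈ _root_.doubling B F ∧ Sum.inl a ∈ T ∧ Sum.inr x ∈ T := by
      intro a x
      obtain ⟨y, hy, huniq⟩ := SimpleGraph.Subgraph.isPerfectMatching_iff.1 (hF.perfect a) x
      refine ⟨{Sum.inl a, Sum.inr x, Sum.inr y}, ⟨Or.inr ⟨a, x, y, hy, rfl⟩, by simp, by simp⟩, ?_⟩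
      rintro T ⟨⟨S, hS, rfl⟩ | ⟨b, p, q, hpq, rfl⟩, h1, h2⟩
      · simp at h2
      · obtain rfl : a = b := by simpa using h1
        have h2 : x = p ∨ x = q := by simpa using h2
        rcases h2 with rfl | rfl
        · rw [huniq q hpq]
        · rw [huniq p hpq.symm, Set.pair_comm]
    rintro (x | x) (y | y) hxy
    · obtain ⟨S, ⟨hS, hx, hy⟩, huniq⟩ := hB.existsUnique_triple x y (by simpa using hxy)
      refine ⟨Sum.inl '' S, ⟨Or.inl ⟨S, hS, rfl⟩, ⟨x, hx, rfl⟩, ⟨y, hy, rfl⟩⟩, ?_⟩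
      rintro T ⟨⟨S', hS', rfl⟩ | ⟨b, p, q, hpq, rfl⟩, h1, h2⟩
      · rw [huniq S' ⟨hS', by simpa using h1, by simpa using h2⟩]
      · have h1 : x = b := by simpa using h1
        have h2 : y = b := by simpa using h2
        exact absurd (congrArg Sum.inl (h1.trans h2.symm)) hxy
    · exact mixed x y
    · simpa only [and_comm (a := Sum.inl y ∈ _)] using mixed y x
    · have hne : x ≠ y := by simpa using hxy
      obtain ⟨a, ha, huniq⟩ := hF.existsUnique_factor x y hne
      refine ⟨{Sum.inl a, Sum.inr x, Sum.inr y}, ⟨Or.inr ⟨a, x, y, ha, rfl⟩, by simp, by simp⟩, ?_⟩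
      rintro T ⟨⟨S, hS, rfl⟩ | ⟨b, p, q, hpq, rfl⟩, h1, h2⟩
      · simp at h2
      · have h1 : x = p ∨ x = q := by simpa using h1
        have h2 : y = p ∨ y = q := by simpa using h2
        rcases h1 with rfl | rfl <;> rcases h2 with rfl | rfl
        · exact absurd rfl hne
        · rw [huniq b hpq]
        · rw [huniq b hpq.symm, Set.pair_comm]
        · exact absurd rfl hne

/-! ### Extending a bicoloring when two classes fill half of the points. -/

/-- The edge colouring of the complete graph on `ℤ/n` together with a point at infinity, `n` odd:
the edge `{x, y}` has colour `x + y`, the edge `{∞, x}` has colour `2 x`. -/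
def starterColour (n : ℕ) : Option (ZMod n) → Option (ZMod n) → ZMod n
  | none, none => 0
  | none, some y => y + y
  | some x, none => x + x
  | some x, some y => x + y

theorem starterColour_comm (n : ℕ) (x y : Option (ZMod n)) :
    starterColour n x y = starterColour n y x := by
  cases x <;> cases y <;> simp [starterColour, add_comm]

/-- The classical round-robin factorization. In the factor `a`, a finite `x` is matched with `a -
x`, except for the fixed point `x = a / 2` of this involution, which is matched with ∞. The fixed
point exists and is unique because `n` is odd. The value at `(none, none)` is a dummy, excluded by
`x ≠ y`. -/
theorem existsUnique_starterColour {n : ℕ} (hn : Odd n) (a : ZMod n) (x : Option (ZMod n)) :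
    ∃! y, x ≠ y ∧ starterColour n x y = a := by
  have h2 : IsUnit (2 : ZMod n) := by
    have := (ZMod.isUnit_iff_coprime 2 n).2 (Nat.coprime_two_left.2 hn)
    exact_mod_cast this
  have hinj : ∀ u w : ZMod n, u + u = w + w → u = w := fun u w h =>
    h2.mul_left_cancel (by rw [two_mul, two_mul, h])
  rcases x with _ | x
  · obtain ⟨u, hu⟩ := h2
    have hhalf : (2 : ZMod n) * (↑u⁻¹ * a) = a := by rw [← hu, Units.mul_inv_cancel_left]
    refine ⟨some (↑u⁻¹ * a), ⟨by simp, by simpa [starterColour, ← two_mul] using hhalf⟩, ?_⟩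
    rintro (_ | y) ⟨h, hy⟩
    · exact absurd rfl h
    · exact congrArg some (hinj _ _ (by rw [← two_mul (_ * a), hhalf]; exact hy))
  -- The solution `a - x` is a legitimate partner unless it is `x` itself, and then ∞ takes its
  -- place.
  · by_cases hx : x + x = a
    · refine ⟨none, ⟨by simp, hx⟩, ?_⟩
      rintro (_ | y) ⟨h, hy⟩
      · rfl
      · have : y = x := add_left_cancel ((show x + y = a from hy).trans hx.symm)
        exact absurd (congrArg some this.symm) h
    · refine ⟨some (a - x), ⟨?_, by simp [starterColour]⟩, ?_⟩
      · intro h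
        apply hx
        have : x = a - x := Option.some_injective _ h
        exact eq_sub_iff_add_eq.1 this
      · rintro (_ | y) ⟨h, hy⟩
        · exact absurd hy hx
        · exact congrArg some (eq_sub_iff_add_eq'.2 hy)

/-- An edge colouring of the complete graph on two copies of `Y`: edges inside a copy are coloured
by `inner`, edges between the copies by `cross`. -/
def twoCopyColour {V Y : Type} (inner cross : Y → Y → V) (p q : Bool × Y) : V :=
  if p.1 = q.1 then inner p.2 q.2 else cross p.2 q.2

/-- If two colour classes of a bicoloured Steiner triple system of order `2 n + 1`, `n` odd, have
`n + 1` points together, then the system has an extended bicoloring. -/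
theorem existsExtendedBicoloring_of_twoClasses {k n : ℕ} (hn : Odd n) {V : Type} [Finite V]
    {B : Set (Set V)} (hV : Nat.card V = 2 * n + 1) (hB : IsSteinerTripleSystem B)
    {φ : V → Fin k} (hφ : IsStrictBicoloring B φ) {c d : Fin k} (hcd : c ≠ d)
    (hcard : Nat.card {a // φ a = c ∨ φ a = d} = n + 1) :
    ExistsExtendedBicoloring k (2 * (2 * n + 1) + 1) := by
  have : NeZero n := ⟨hn.pos.ne'⟩
  have hY : Nat.card (Option (ZMod n)) = n + 1 := by
    rw [Finite.card_option, Nat.card_zmod]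
  -- `Y` carries two labellings: by `ℤ/n` with ∞ for the edges inside a copy, and by `ℤ/(n + 1)` for
  -- the edges across.
  obtain ⟨y⟩ : Nonempty (Option (ZMod n) ≃ ZMod (n + 1)) :=
    Finite.card_eq.1 (by rw [hY, Nat.card_zmod])
  obtain ⟨e⟩ : Nonempty (ZMod (n + 1) ≃ {a // φ a = c ∨ φ a = d}) :=
    Finite.card_eq.1 (by rw [hcard, Nat.card_zmod])
  -- The points outside the two classes number (2n + 1) - (n + 1) = n, one for each inner factor.
  have hrest : Nat.card {a // ¬ (φ a = c ∨ φ a = d)} = n := by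
    classical
    have := Nat.card_congr (Equiv.sumCompl fun a => φ a = c ∨ φ a = d)
    rw [Nat.card_sum] at this
    omega
  obtain ⟨r⟩ : Nonempty (ZMod n ≃ {a // ¬ (φ a = c ∨ φ a = d)}) :=
    Finite.card_eq.1 (by rw [hrest, Nat.card_zmod])
  let inner : Option (ZMod n) → Option (ZMod n) → V := fun p q => r (starterColour n p q)
  -- The addition table of `ℤ/(n + 1)` is a Latin square, so each colour gives a matching across;
  -- its symmetry makes the edge colouring symmetric.
  let cross : Option (ZMod n) → Option (ZMod n) → V := fun p q => e (y p + y q)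
  let f := twoCopyColour inner cross
  have hf : ∀ p q, f p q = f q p := by
    intro p q
    simp only [f, twoCopyColour, inner, cross, starterColour_comm n p.2 q.2, add_comm (y p.2),
      eq_comm (a := p.1)]
  have f_same : ∀ i p q, f (i, p) (i, q) = r (starterColour n p q) := fun i p q => if_pos rfl
  have f_ne : ∀ i j p q, i ≠ j → f (i, p) (j, q) = e (y p + y q) := fun i j p q h => if_neg h
  clear_value f
  have hF : IsOneFactorization (factor f hf) := by
    apply isOneFactorization_factor
    rintro a ⟨i, p⟩
    -- The colour of `a` decides where its factor lives: across the copies if it is `c` or `d`,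
    -- inside them otherwise.
    by_cases ha : φ a = c ∨ φ a = d
    · refine ⟨(!i, y.symm (e.symm ⟨a, ha⟩ - y p)), ⟨by simp, by rw [f_ne _ _ _ _ (by simp)]; simp⟩,
        ?_⟩
      rintro ⟨j, q⟩ ⟨-, hq⟩
      by_cases hij : i = j
      · subst hij
        rw [f_same] at hq
        exact absurd ha (hq ▸ (r _).2)
      · rw [f_ne _ _ _ _ hij] at hq
        have hq : e (y p + y q) = ⟨a, ha⟩ := Subtype.ext hq
        refine Prod.ext (Bool.eq_not.2 (Ne.symm hij)) ?_
        rw [← hq, e.symm_apply_apply, add_sub_cancel_left, y.symm_apply_apply]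
    · obtain ⟨q, ⟨hpq, hq⟩, huniq⟩ := existsUnique_starterColour hn (r.symm ⟨a, ha⟩) p
      refine ⟨(i, q), ⟨fun h => hpq (congrArg Prod.snd h), by rw [f_same, hq]; simp⟩, ?_⟩
      rintro ⟨j, q'⟩ ⟨hne, hq'⟩
      by_cases hij : i = j
      · subst hij
        rw [f_same] at hq'
        have hq' : r (starterColour n p q') = ⟨a, ha⟩ := Subtype.ext hq'
        rw [huniq q' ⟨fun h => hne (congrArg (Prod.mk i) h), by rw [← hq', r.symm_apply_apply]⟩]
      · rw [f_ne _ _ _ _ hij] at hq'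
        exact absurd (hq' ▸ (e _).2) ha
  refine ⟨V, Bool × Option (ZMod n), inferInstance, inferInstance, B, factor f hf, φ,
    Sum.elim φ fun p => if p.1 then c else d, ?_, by rw [hV], hB, hF, hB.doubling hF, hφ,
    ⟨?_, ?_⟩, fun _ => rfl⟩
  · rw [Nat.card_prod, hY, hV]
    simp
    ring
  · rintro T (⟨S, hS, rfl⟩ | ⟨a, ⟨i, p⟩, ⟨j, q⟩, ⟨-, hpq⟩, rfl⟩)
    · rw [Set.image_image]
      exact hφ.two_colors S hS
    · simp only [Set.image_insert_eq, Set.image_singleton, Sum.elim_inl, Sum.elim_inr]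
      -- Inside a copy the two points of `X` share a colour from which that of `a` differs. Across,
      -- they have colours `c` and `d`, and `a` repeats one of them.
      by_cases hij : i = j
      · subst hij
        rw [f_same] at hpq
        have ha : ¬ (φ a = c ∨ φ a = d) := hpq ▸ (r _).2
        rw [Set.pair_eq_singleton]
        apply Set.ncard_pair
        rw [not_or] at ha
        cases i
        exacts [ha.2, ha.1]
      · rw [f_ne _ _ _ _ hij] at hpq
        have ha : φ a = c ∨ φ a = d := hpq ▸ (e _).2
        -- Writing 2 as the size of `{c, d}` leaves an equality of colour sets.
        rw [← Set.ncard_pair hcd]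
        congr 1
        ext t
        cases i <;> cases j <;> rcases ha with ha | ha <;> simp [ha] at hij ⊢ <;> tauto
  · intro t
    obtain ⟨a, ha⟩ := hφ.surjective t
    exact ⟨Sum.inl a, ha⟩

/-! ### Encoding bicoloured triple systems as natural numbers. -/

/-- The colour of the point `x` when the points are numbered class by class and `sizes` lists the
sizes of the colour classes. -/
def classOf : List ℕ → ℕ → ℕ
  | [], _ => 0
  | s :: sizes, x => bif x.blt s then 0 else (classOf sizes (x - s)).succ

/-- The entry at `(x, y)` of the operation table on `v ≤ 127` points that is stored, in base `128`,
as the natural number `t`. Stored values are increased by one, so that `0` marks an empty entry. -/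
def entry (v t x y : ℕ) : ℕ := (t >>> (7 * (v * x + y))) % 128

/-- The number which, added to a table, stores `{x, y, z}` as a triple. -/
def tripleCode (v x y z : ℕ) : ℕ :=
  ((z + 1) <<< (7 * (v * x + y)) + (z + 1) <<< (7 * (v * y + x))) +
  ((y + 1) <<< (7 * (v * x + z)) + (y + 1) <<< (7 * (v * z + x))) +
  ((x + 1) <<< (7 * (v * y + z)) + (x + 1) <<< (7 * (v * z + y)))

/-- Function application that makes the kernel evaluate the argument first. -/
def applyEvaluated {α : Type} (n : ℕ) (f : ℕ → α) : α :=
  match n with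
  | 0 => f 0
  | k + 1 => f k.succ

/-- Run through a list of pairs; complete each pair that the table `t` does not cover yet to a
triple, whose third point is the next element of the list `l`. -/
def completePairs (v : ℕ) : List (ℕ × ℕ) → List ℕ → ℕ → ℕ
  | [], _, t => t
  | (x, y) :: pairs, l, t =>
    bif (entry v t x y).beq 0 then
      match l with
      | [] => t
      | z :: l => applyEvaluated (t + tripleCode v x y z) (completePairs v pairs l)
    else completePairs v pairs l t

/-- The pairs `x < y < v` in lexicographic order. -/
def pairsBelow (v : ℕ) : List (ℕ × ℕ) :=
  (List.range v).flatMap fun x => ((List.range v).filter x.blt).map (Prod.mk x)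

/-- The table of the triple system whose triples `{x < y < z}`, in lexicographic order, have third
points `l`. -/
def tableOf (v : ℕ) (l : List ℕ) : ℕ := completePairs v (pairsBelow v) l 0

/-- The third point, according to the table `t`, of the triple through `x` and `y`. -/
def thirdPoint (v t x y : ℕ) : ℕ := entry v t x y - 1

/-- For distinct `x` and `y`, the point `z` is a possible third point in a bicoloured system. -/
def goodThird (sizes : List ℕ) (v t x y z : ℕ) : Bool :=
  z.blt v && !(z.beq x) && (thirdPoint v t y x).beq z && (thirdPoint v t x z).beq y &&
    (bif (classOf sizes x).beq (classOf sizes y) then !((classOf sizes z).beq (classOf sizes x))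
      else ((classOf sizes z).beq (classOf sizes x) || (classOf sizes z).beq (classOf sizes y)))

/-- The table `t` describes a Steiner triple system on `v` points, bicoloured by `classOf sizes`. -/
def isBicolouredTable (sizes : List ℕ) (v t : ℕ) : Bool :=
  (List.range v).all fun x => (List.range v).all fun y =>
    x.beq y || goodThird sizes v t x y (thirdPoint v t x y)

/-! ### From a checked table to an extended bicoloring. -/

theorem classOf_cons (s : ℕ) (sizes : List ℕ) (x : ℕ) :
    classOf (s :: sizes) x = if x < s then 0 else classOf sizes (x - s) + 1 := by
  rw [classOf, Bool.cond_eq_ite]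
  exact if_congr (iff_of_eq Nat.blt_eq) rfl rfl

theorem classOf_lt {sizes : List ℕ} {x : ℕ} (hx : x < sizes.sum) :
    classOf sizes x < sizes.length := by
  induction sizes generalizing x with
  | nil => simp at hx
  | cons s sizes ih =>
    rw [List.sum_cons] at hx
    by_cases h : x < s
    · simp [classOf_cons, h]
    · have := @ih (x - s) (by omega)
      simp [classOf_cons, h, this]

/-- Needed for strictness: nonempty classes make the colouring surjective. -/
theorem exists_classOf_eq {sizes : List ℕ} (hpos : ∀ s ∈ sizes, 0 < s) {i : ℕ}
    (hi : i < sizes.length) : ∃ x < sizes.sum, classOf sizes x = i := by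
  induction sizes generalizing i with
  | nil => simp at hi
  | cons s sizes ih =>
    rw [List.forall_mem_cons] at hpos
    cases i with
    | zero => exact ⟨0, by rw [List.sum_cons]; omega, by simp [classOf_cons, hpos.1]⟩
    | succ i =>
      obtain ⟨x, hx, hxi⟩ := ih hpos.2 (by simpa using hi)
      exact ⟨s + x, by rw [List.sum_cons]; omega, by simp [classOf_cons, hxi]⟩

/-- Points are numbered class by class, so the first two classes form an initial segment; this
counts the points in them. -/
theorem classOf_eq_zero_or_one {p q : ℕ} {sizes : List ℕ} {x : ℕ} :
    classOf (p :: q :: sizes) x = 0 ∨ classOf (p :: q :: sizes) x = 1 ↔ x < p + q := by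
  by_cases hp : x < p
  · simp [classOf_cons, hp]; omega
  · by_cases hq : x - p < q
    · simp [classOf_cons, hp, hq]; omega
    · simp [classOf_cons, hp, hq]; omega

/-- Soundness rests only on the tests applied to `thirdPoint`, not on how the table was filled: an
empty entry, read as the point 0 by truncated subtraction, has to pass the same tests as any other.
These tests are the axioms of `IsThirdPoint` together with the colour condition. -/
theorem existsExtendedBicoloring_of_table {v n p q t : ℕ} {sizes : List ℕ}
    (h : isBicolouredTable (p :: q :: sizes) v t = true) (hvn : v = 2 * n + 1) (hn : Odd n)
    (hpq : p + q = n + 1) (hsum : sizes.sum = n) (hpos : ∀ s ∈ p :: q :: sizes, 0 < s) :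
    ExistsExtendedBicoloring (sizes.length + 2) (2 * v + 1) := by
  subst hvn
  have hv : (p :: q :: sizes).sum = 2 * n + 1 := by simp only [List.sum_cons]; omega
  simp only [isBicolouredTable, goodThird, List.all_eq_true, List.mem_range, Bool.or_eq_true,
    Nat.beq_eq, Bool.and_eq_true, Nat.blt_eq, Bool.cond_eq_ite] at h
  have hlt : ∀ x y : Fin (2 * n + 1), x ≠ y → thirdPoint (2 * n + 1) t x y < 2 * n + 1 := by
    intro x y hxy
    have := h x x.2 y y.2
    rw [Fin.val_inj] at this
    exact (this.resolve_left hxy).1.1.1.1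
  -- The check says nothing about the diagonal, so `op x x` gets the dummy value `x`.
  let op : Fin (2 * n + 1) → Fin (2 * n + 1) → Fin (2 * n + 1) := fun x y =>
    if hxy : x ≠ y then ⟨thirdPoint (2 * n + 1) t x y, hlt x y hxy⟩ else x
  have op_val : ∀ x y, x ≠ y → (op x y : ℕ) = thirdPoint (2 * n + 1) t x y := fun x y hxy => by
    simp only [op, dif_pos hxy]
  have hop : IsThirdPoint op := by
    have h1 : ∀ x y, x ≠ y → op x y ≠ x := by
      intro x y hxy he
      have := (h x x.2 y y.2).resolve_left (mt Fin.val_inj.1 hxy)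
      rw [← op_val x y hxy, he] at this
      simp at this
    refine ⟨h1, ?_, ?_⟩
    · intro x y hxy
      have := (h x x.2 y y.2).resolve_left (mt Fin.val_inj.1 hxy)
      rw [← op_val x y hxy, ← op_val y x hxy.symm] at this
      exact Fin.val_inj.1 this.1.1.2
    · intro x y hxy
      have := (h x x.2 y y.2).resolve_left (mt Fin.val_inj.1 hxy)
      rw [← op_val x y hxy, ← op_val x _ (h1 x y hxy).symm] at this
      exact Fin.val_inj.1 this.1.2
  let φ : Fin (2 * n + 1) → Fin (sizes.length + 2) := fun x =>
    ⟨classOf (p :: q :: sizes) x, classOf_lt (hv.symm ▸ x.2)⟩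
  have hφ : IsStrictBicoloring (triplesOf op) φ := by
    refine ⟨?_, ?_⟩
    · rintro T ⟨x, y, hxy, rfl⟩
      have := ((h x x.2 y y.2).resolve_left (mt Fin.val_inj.1 hxy)).2
      rw [← op_val x y hxy] at this
      rw [Set.image_insert_eq, Set.image_pair]
      -- Two points of one colour need a third of another colour; two points of different colours
      -- need a third that repeats one of them.
      split_ifs at this with hc
      · have hc : φ x = φ y := Fin.val_inj.1 hc
        have hz : φ (op x y) ≠ φ x := by
          simpa only [φ, ne_eq, Fin.ext_iff, Bool.not_eq_true', ← Bool.not_eq_true, Nat.beq_eq] using this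
        rw [← hc, Set.insert_eq_of_mem (Set.mem_insert _ _), Set.ncard_pair hz.symm]
      · have hc : φ x ≠ φ y := mt (congrArg Fin.val) hc
        have hz : φ (op x y) = φ x ∨ φ (op x y) = φ y := by
          simpa only [Bool.or_eq_true, Nat.beq_eq, φ, Fin.mk.injEq] using this
        rcases hz with hz | hz
        · rw [hz, Set.pair_comm (φ y), Set.insert_eq_of_mem (Set.mem_insert _ _),
            Set.ncard_pair hc]
        · rw [hz, Set.pair_eq_singleton, Set.ncard_pair hc]
    · rintro ⟨i, hi⟩
      obtain ⟨x, hx, hxi⟩ := exists_classOf_eq hpos hi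
      exact ⟨⟨x, hv ▸ hx⟩, Fin.ext hxi⟩
  refine existsExtendedBicoloring_of_twoClasses hn (Nat.card_fin _) hop.isSteinerTripleSystem hφ
    (c := 0) (d := 1) (by simp) ?_
  have hiff : ∀ x : Fin (2 * n + 1), (φ x = 0 ∨ φ x = 1) ↔ (x : ℕ) < n + 1 := by
    intro x
    rw [← hpq, ← classOf_eq_zero_or_one (sizes := sizes), ← Fin.val_inj, ← Fin.val_inj]
    simp [φ]
  rw [Nat.card_congr (Equiv.subtypeEquivRight hiff), Nat.card_eq_fintype_card,
    Fintype.card_subtype]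
  simp only [Fin.card_filter_val_lt]
  omega

/-! ### The 4-bicoloured systems, of orders 63, 75, 79 and 87. -/

/-- Third points of a 4-bicoloured Steiner triple system of order 63 with colour classes of
sizes 18, 14, 29 and 2, one row for each smallest point. -/
def fourColoured63 : List (List ℕ) :=
  [[22, 27, 32, 60, 61, 57, 19, 56, 23, 62, 29, 20, 21, 18, 25, 28, 42, 30, 31, 45, 37, 49, 41,
    53, 59, 51, 52, 50, 55, 58, 54], [50, 35, 27, 62, 19, 18, 28, 47, 52, 53, 58, 30, 61, 29, 43,
    24, 23, 31, 26, 33, 41, 42, 55, 45, 57, 48, 60, 54, 56, 59], [29, 18, 28, 59, 23, 40, 25, 21,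
    51, 24, 61, 49, 62, 20, 30, 31, 26, 52, 43, 55, 54, 57, 39, 56, 45, 53, 47, 48, 60], [34, 41,
    36, 28, 21, 46, 61, 62, 31, 25, 44, 30, 27, 18, 20, 24, 26, 48, 50, 57, 40, 58, 55, 47, 51,
    59, 60, 56], [53, 30, 61, 59, 40, 20, 26, 42, 62, 24, 21, 23, 38, 22, 29, 31, 37, 39, 47, 51,
    50, 46, 58, 49, 56, 55, 57], [33, 27, 46, 38, 29, 19, 30, 22, 26, 18, 39, 58, 21, 31, 25, 34,
    44, 60, 54, 43, 55, 52, 57, 59, 50, 56], [22, 25, 62, 24, 23, 61, 26, 20, 31, 21, 44, 28, 29,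
    58, 52, 42, 53, 39, 47, 46, 51, 55, 50, 54, 60], [62, 51, 30, 35, 25, 39, 43, 20, 26, 34, 24,
    31, 54, 52, 56, 60, 40, 49, 48, 55, 50, 58, 53, 59], [20, 31, 33, 26, 60, 19, 47, 22, 61, 30,
    27, 29, 53, 38, 51, 55, 49, 41, 44, 48, 57, 52, 58], [53, 50, 56, 58, 29, 19, 61, 21, 24, 31,
    30, 28, 43, 34, 41, 39, 42, 52, 59, 55, 57, 60], [18, 23, 41, 56, 28, 35, 26, 25, 27, 44, 59,
    47, 37, 48, 46, 45, 43, 55, 60, 54, 58], [22, 45, 31, 61, 24, 37, 25, 27, 30, 38, 43, 48, 44,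
    58, 47, 52, 49, 55, 57, 60], [29, 62, 51, 48, 19, 27, 28, 46, 41, 39, 50, 43, 44, 59, 55, 54,
    52, 60, 57], [54, 55, 31, 23, 20, 28, 27, 47, 37, 50, 43, 40, 52, 51, 53, 56, 57, 59], [41,
    25, 36, 23, 28, 30, 60, 53, 48, 55, 59, 47, 50, 42, 58, 57, 52], [40, 27, 23, 26, 57, 44, 46,
    38, 53, 45, 43, 49, 60, 56, 58, 59], [62, 29, 30, 49, 42, 57, 46, 52, 54, 59, 45, 60, 53, 58,
    56], [31, 25, 29, 50, 57, 45, 49, 41, 54, 59, 48, 55, 60, 56], [50, 61, 62, 43, 38, 46, 45,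
    59, 55, 42, 60, 54, 56, 58, 52, 57, 51, 49, 53], [32, 61, 62, 55, 42, 48, 54, 44, 39, 49, 51,
    58, 57, 52, 60, 56, 47, 59], [39, 61, 57, 54, 62, 52, 44, 51, 50, 40, 48, 47, 38, 55, 59, 45,
    60, 53, 58], [60, 34, 54, 45, 62, 51, 57, 59, 40, 49, 42, 58, 56, 48, 52, 50, 55], [49, 61,
    42, 35, 54, 44, 46, 51, 50, 56, 57, 48, 55, 53, 59], [57, 37, 59, 62, 36, 45, 56, 35, 44, 55,
    46, 53, 60, 51, 58, 52, 54], [47, 37, 39, 36, 60, 46, 41, 53, 45, 49, 56, 51, 58, 54, 59],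
    [49, 61, 55, 62, 56, 58, 59, 50, 48, 60, 44, 54, 47, 51, 53, 57], [62, 32, 61, 40, 45, 52, 58,
    43, 42, 60, 48, 49, 56, 59, 53], [61, 41, 38, 36, 53, 58, 47, 44, 50, 46, 52, 60, 57, 59],
    [46, 58, 56, 52, 48, 55, 45, 49, 42, 53, 54, 51, 60], [33, 35, 56, 38, 47, 51, 59, 54, 46, 44,
    57, 58, 60], [52, 48, 59, 37, 60, 54, 56, 43, 47, 53, 50, 58, 57], [36, 47, 53, 58, 43, 56,
    54, 60, 57, 59, 51, 49, 55], [62, 61], [62, 61], [61, 62], [62, 61], [61], [62, 61], [62, 61],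
    [61, 62], [61], [62, 61], [61, 62], [61, 62], [62], [62, 61], [62], [62], [61], [62]]

/-- By evaluation: the table is rebuilt from the list and all ordered pairs of distinct points are
tested. Flattening loses nothing, since each entry belongs to the first pair, in lexicographic
order, not yet covered. The first two sizes add up to 32 = (63 + 1) / 2, as the extension requires.
-/
theorem isBicolouredTable_fourColoured63 :
    isBicolouredTable [18, 14, 29, 2] 63 (tableOf 63 fourColoured63.flatten) = true := by
  decide +kernel

/-- Third points of a 4-bicoloured Steiner triple system of order 75 with colour classes of
sizes 26, 12, 33 and 4, one row for each smallest point. -/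
def fourColoured75 : List (List ℕ) :=
  [[35, 73, 31, 36, 26, 47, 33, 52, 56, 30, 72, 28, 34, 29, 50, 66, 55, 74, 37, 71, 65, 32, 27,
    42, 58, 57, 69, 62, 49, 48, 60, 64, 70, 68, 54, 61, 67], [67, 62, 26, 52, 72, 71, 74, 34, 63,
    49, 59, 31, 51, 29, 37, 66, 70, 40, 27, 54, 30, 33, 28, 73, 36, 42, 68, 43, 57, 47, 65, 58,
    60, 61, 56, 69], [71, 74, 65, 26, 52, 64, 55, 35, 60, 69, 56, 36, 33, 40, 27, 32, 31, 28, 37,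
    50, 38, 29, 72, 34, 49, 47, 44, 59, 70, 58, 53, 57, 62, 68, 66], [42, 27, 33, 26, 43, 32, 72,
    30, 37, 73, 69, 68, 67, 34, 50, 46, 74, 45, 53, 51, 36, 28, 35, 61, 56, 63, 65, 52, 57, 66,
    64, 55, 60, 70], [33, 50, 34, 48, 71, 68, 32, 27, 29, 41, 54, 52, 31, 72, 44, 57, 70, 73, 45,
    63, 47, 30, 37, 55, 60, 66, 53, 51, 59, 65, 64, 69, 67], [63, 46, 37, 73, 28, 34, 29, 49, 71,
    59, 64, 74, 62, 39, 32, 35, 72, 36, 45, 44, 31, 41, 43, 48, 55, 67, 58, 70, 57, 66, 61, 69],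
    [51, 68, 58, 44, 41, 55, 66, 70, 42, 73, 30, 28, 43, 35, 34, 71, 74, 32, 29, 36, 37, 54, 65,
    48, 61, 57, 62, 56, 60, 69, 67], [69, 47, 27, 64, 32, 50, 37, 30, 56, 72, 36, 35, 29, 73, 60,
    61, 74, 41, 31, 67, 54, 49, 62, 55, 45, 57, 66, 63, 68, 70], [53, 31, 63, 71, 33, 30, 70, 26,
    61, 60, 32, 72, 36, 49, 39, 73, 27, 35, 34, 46, 45, 44, 59, 66, 62, 54, 57, 67, 65], [33, 28,
    65, 67, 61, 35, 30, 37, 29, 74, 36, 72, 27, 59, 26, 31, 69, 43, 60, 51, 66, 54, 46, 64, 68,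
    57, 62, 70], [26, 38, 43, 74, 53, 71, 36, 48, 29, 73, 64, 37, 32, 34, 45, 70, 61, 58, 49, 50,
    52, 66, 56, 65, 69, 67, 62], [31, 36, 27, 74, 69, 35, 73, 67, 37, 71, 29, 53, 48, 33, 47, 46,
    70, 68, 57, 59, 50, 61, 54, 62, 58, 66], [61, 72, 36, 62, 49, 43, 26, 46, 30, 74, 73, 56, 34,
    35, 40, 50, 52, 67, 58, 54, 51, 57, 70, 64, 68], [54, 71, 42, 59, 37, 58, 48, 68, 26, 30, 72,
    74, 35, 32, 70, 52, 65, 69, 46, 53, 51, 63, 60, 64], [73, 59, 28, 35, 34, 40, 32, 33, 63, 66,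
    67, 31, 64, 45, 53, 50, 48, 68, 65, 52, 60, 62, 58], [72, 69, 41, 45, 34, 31, 61, 57, 46, 32,
    27, 37, 39, 64, 56, 63, 48, 58, 60, 55, 66, 67], [32, 34, 28, 70, 74, 36, 35, 49, 55, 29, 33,
    60, 47, 48, 61, 51, 68, 54, 63, 58, 65], [71, 73, 51, 33, 48, 29, 68, 26, 63, 41, 57, 60, 67,
    47, 65, 62, 70, 53, 58, 64], [38, 26, 40, 39, 31, 33, 65, 30, 45, 58, 53, 56, 57, 52, 69, 59,
    63, 66, 68], [33, 27, 52, 72, 71, 53, 36, 70, 65, 62, 50, 55, 63, 59, 61, 68, 64, 69], [60,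
    31, 43, 39, 30, 59, 56, 61, 62, 66, 69, 53, 58, 64, 63, 67, 68], [28, 41, 47, 57, 29, 51, 50,
    46, 58, 66, 52, 67, 63, 61, 69, 62], [62, 57, 40, 35, 58, 67, 63, 68, 64, 69, 55, 59, 65, 66,
    70], [44, 71, 37, 34, 47, 50, 52, 56, 70, 68, 58, 69, 65, 67], [37, 31, 35, 52, 54, 64, 70,
    69, 62, 55, 61, 65, 67], [36, 66, 64, 43, 56, 59, 69, 51, 60, 70, 62, 68], [72, 38, 39, 62,
    42, 71, 51, 52, 59, 69, 61, 60, 67, 50, 49, 65, 64, 66, 68, 63, 70, 74], [71, 74, 47, 72, 73,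
    44, 57, 42, 45, 51, 66, 62, 65, 61, 70, 56, 60, 69, 67, 63, 68], [73, 74, 58, 56, 66, 44, 52,
    47, 54, 49, 63, 69, 59, 67, 68, 64, 61, 65, 70], [72, 74, 58, 57, 54, 71, 45, 42, 67, 60, 47,
    56, 59, 55, 66, 68, 53, 69, 65, 63, 70], [71, 73, 74, 55, 46, 66, 54, 65, 50, 57, 64, 68, 63,
    69, 67, 62, 60, 59, 70], [72, 71, 73, 38, 48, 59, 62, 64, 60, 65, 56, 49, 53, 66, 55, 61, 67,
    70, 68, 69], [66, 73, 60, 46, 62, 69, 61, 57, 49, 55, 54, 67, 70, 56, 59, 68, 64, 65], [54,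
    71, 72, 65, 58, 68, 53, 55, 52, 49, 59, 48, 64, 56, 63, 67, 70], [74, 56, 49, 51, 41, 46, 53,
    67, 63, 61, 55, 57, 69, 64, 66, 65, 70], [50, 67, 55, 68, 58, 66, 70, 52, 47, 63, 61, 64, 59,
    65, 57, 69, 74], [64, 59, 56, 57, 67, 62, 68, 63, 61, 49, 60, 53, 66, 70, 69, 73], [48, 63,
    58, 55, 51, 44, 62, 61, 54, 65, 59, 69, 66, 68, 70], [73, 72, 71, 74], [74, 73, 71, 72], [71,
    74, 72], [72, 73, 71, 74], [73, 71, 74], [71, 73, 74], [73, 72], [74, 72, 73], [71, 72, 74],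
    [74, 73, 71, 72], [73, 72, 71], [73, 71, 74, 72], [72, 74], [73], [73, 71, 74], [74], [72],
    [72, 74], [71, 72], [72, 74, 71, 73], [71, 72], [74, 73], [73, 74], [73], [73], [71], [72]]

theorem isBicolouredTable_fourColoured75 :
    isBicolouredTable [26, 12, 33, 4] 75 (tableOf 75 fourColoured75.flatten) = true := by
  decide +kernel

/-- Third points of a 4-bicoloured Steiner triple system of order 79 with colour classes of
sizes 36, 4, 25 and 14, one row for each smallest point. -/
def fourColoured79 : List (List ℕ) :=
  [[44, 52, 38, 76, 54, 53, 48, 39, 58, 59, 73, 68, 36, 55, 71, 77, 46, 61, 72, 45, 69, 51, 47,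
    60, 70, 37, 78, 63, 74, 50, 66, 67, 65, 75, 62, 43, 57, 64, 56], [61, 57, 63, 76, 41, 54, 68,
    69, 38, 52, 58, 73, 75, 39, 59, 74, 45, 43, 50, 65, 66, 42, 48, 53, 70, 77, 40, 37, 71, 67,
    46, 78, 36, 72, 60, 51, 56, 64], [42, 60, 72, 73, 44, 49, 46, 68, 47, 78, 71, 67, 56, 66, 55,
    38, 63, 69, 43, 62, 39, 70, 37, 40, 48, 50, 36, 59, 58, 45, 74, 51, 41, 57, 64, 77, 76], [52,
    37, 62, 67, 74, 44, 55, 53, 71, 66, 58, 68, 70, 77, 49, 78, 51, 76, 59, 40, 64, 61, 36, 50,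
    69, 41, 56, 63, 72, 39, 45, 75, 46, 54, 60, 73], [43, 68, 65, 47, 36, 78, 61, 54, 67, 77, 42,
    58, 53, 44, 62, 48, 72, 46, 69, 40, 39, 49, 66, 64, 71, 37, 70, 75, 73, 38, 74, 45, 56, 57,
    59], [66, 77, 55, 60, 51, 78, 64, 44, 68, 59, 65, 62, 52, 36, 67, 38, 45, 49, 74, 75, 71, 42,
    70, 39, 69, 47, 48, 57, 73, 61, 46, 50, 56, 63], [39, 78, 61, 72, 65, 48, 60, 44, 37, 40, 56,
    71, 42, 47, 59, 74, 64, 55, 50, 67, 58, 38, 46, 70, 69, 51, 75, 43, 36, 63, 54, 57, 77], [75,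
    59, 42, 37, 74, 56, 78, 70, 51, 43, 53, 46, 71, 64, 38, 72, 52, 58, 69, 36, 57, 66, 41, 73,
    47, 50, 68, 76, 62, 49, 63, 61], [67, 71, 43, 61, 41, 63, 66, 46, 36, 69, 60, 56, 77, 70, 76,
    42, 38, 51, 44, 73, 72, 52, 37, 58, 40, 48, 65, 64, 59, 62, 57], [66, 70, 53, 78, 38, 48, 74,
    50, 43, 47, 73, 37, 57, 68, 71, 55, 41, 49, 39, 77, 63, 64, 62, 72, 76, 56, 42, 54, 52, 75],
    [36, 39, 76, 41, 69, 49, 44, 73, 70, 37, 46, 61, 56, 67, 47, 65, 74, 48, 75, 53, 40, 54, 62,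
    77, 58, 52, 60, 57, 64], [46, 39, 59, 55, 57, 66, 42, 54, 68, 50, 71, 75, 69, 49, 44, 60, 77,
    58, 40, 74, 38, 56, 67, 64, 63, 48, 62, 76], [69, 70, 72, 45, 38, 51, 56, 55, 42, 36, 62, 75,
    76, 57, 37, 60, 73, 77, 43, 66, 49, 65, 67, 44, 59, 50, 63], [53, 74, 62, 61, 37, 52, 54, 68,
    65, 38, 72, 42, 47, 45, 75, 40, 64, 57, 70, 77, 49, 50, 55, 63, 59, 58], [51, 50, 37, 74, 76,
    62, 73, 72, 60, 46, 66, 48, 54, 47, 64, 43, 39, 36, 69, 57, 42, 45, 52, 61, 71], [73, 41, 75,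
    44, 78, 57, 63, 53, 45, 36, 60, 46, 65, 49, 61, 62, 64, 76, 58, 38, 47, 50, 54, 77], [39, 48,
    38, 36, 71, 60, 54, 63, 44, 43, 41, 61, 55, 47, 42, 68, 53, 52, 37, 64, 72, 76, 78], [67, 45,
    64, 70, 47, 65, 54, 40, 76, 51, 71, 69, 75, 68, 78, 60, 63, 49, 57, 52, 59, 73], [40, 63, 60,
    39, 55, 76, 64, 68, 72, 66, 70, 46, 36, 65, 41, 78, 77, 58, 62, 56, 59], [58, 48, 75, 73, 50,
    69, 39, 53, 37, 67, 65, 41, 77, 68, 55, 66, 57, 61, 64, 74], [39, 40, 70, 65, 46, 77, 59, 41,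
    38, 66, 76, 74, 43, 60, 52, 53, 49, 61, 75], [49, 36, 66, 52, 74, 61, 54, 51, 55, 78, 63, 47,
    40, 53, 44, 62, 58, 75], [41, 43, 73, 64, 68, 67, 53, 54, 77, 55, 37, 42, 69, 52, 56, 58, 78],
    [37, 63, 66, 43, 78, 50, 58, 51, 57, 45, 44, 48, 52, 61, 71, 77], [77, 58, 73, 36, 57, 68, 44,
    41, 38, 39, 78, 53, 61, 56, 62], [72, 65, 74, 68, 78, 71, 59, 67, 62, 57, 56, 45, 54, 60],
    [56, 45, 78, 38, 75, 53, 46, 59, 73, 54, 61, 55, 63], [52, 63, 67, 38, 39, 71, 64, 40, 57, 62,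
    75, 76], [59, 76, 56, 42, 58, 72, 68, 51, 55, 62, 53], [45, 65, 76, 48, 61, 60, 56, 47, 54,
    62], [72, 73, 36, 74, 39, 48, 51, 60, 62], [61, 59, 54, 46, 53, 50, 55, 60], [44, 37, 43, 49,
    52, 60, 71], [66, 70, 51, 61, 63, 64], [71, 47, 56, 53, 70], [59, 55, 63, 54], [75, 60, 69,
    53, 48, 49, 54, 57, 47, 55, 51, 59, 63, 64, 62, 78, 72, 68, 77, 76, 74], [54, 76, 50, 60, 62,
    56, 58, 57, 48, 52, 64, 53, 61, 63, 66, 78, 74, 77, 72, 73], [51, 58, 61, 50, 48, 46, 59, 55,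
    63, 53, 62, 64, 76, 77, 69, 71, 73, 78, 75], [60, 54, 52, 57, 62, 56, 50, 64, 55, 58, 59, 63,
    67, 73, 78, 74, 75, 77], [67, 78, 72, 75, 66, 71, 77, 74, 69, 73, 65, 76, 70], [74, 70, 66,
    71, 65, 76, 78, 72, 73, 75, 69, 77], [75, 65, 70, 69, 72, 73, 77, 76, 78, 68, 71, 67], [68,
    78, 67, 66, 71, 74, 69, 76, 77, 73, 72], [75, 74, 69, 71, 76, 72, 66, 78, 67, 70, 77], [67,
    76, 69, 68, 65, 77, 71, 74, 78], [78, 73, 71, 72, 74, 65, 76, 68, 77, 70, 75], [75, 68, 67,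
    69, 77, 71, 65, 70, 76], [66, 68, 65, 77, 70, 76, 67, 73, 74, 72], [70, 67, 72, 69, 76, 77],
    [75, 77, 65, 66, 78, 74, 72, 73], [76, 74, 70, 66, 75, 78], [71, 78, 77, 70, 74, 73, 72], [77,
    70, 69, 73, 66, 74, 71, 75], [65, 72, 73, 76, 67, 78, 69, 71], [75, 67, 68, 78, 74], [73, 65,
    68, 76, 75, 78], [68, 69, 72, 76, 70, 78], [71, 75, 74], [72, 75, 78], [70, 75, 67], [72, 74],
    [69, 73, 77], [76, 78], [68]]

theorem isBicolouredTable_fourColoured79 :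
    isBicolouredTable [36, 4, 25, 14] 79 (tableOf 79 fourColoured79.flatten) = true := by
  decide +kernel

/-- Third points of a 4-bicoloured Steiner triple system of order 87 with colour classes of
sizes 40, 4, 26 and 17, one row for each smallest point. -/
def fourColoured87 : List (List ℕ) :=
  [[44, 43, 74, 73, 41, 64, 65, 75, 67, 83, 85, 76, 52, 71, 45, 48, 80, 79, 60, 81, 51, 77, 49,
    57, 63, 86, 78, 54, 56, 70, 42, 59, 61, 66, 72, 58, 40, 46, 62, 53, 55, 69, 84], [66, 86, 77,
    57, 61, 40, 82, 42, 46, 72, 48, 85, 62, 84, 59, 76, 83, 70, 58, 74, 53, 60, 78, 65, 47, 67,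
    80, 68, 69, 43, 41, 79, 49, 54, 55, 51, 52, 50, 64, 63, 81, 75], [48, 67, 55, 74, 52, 84, 75,
    44, 86, 59, 61, 72, 42, 46, 81, 45, 73, 79, 77, 83, 76, 53, 50, 85, 65, 49, 60, 63, 71, 51,
    58, 47, 82, 40, 41, 54, 80, 69, 64, 68, 78], [41, 49, 80, 69, 73, 63, 84, 40, 68, 82, 51, 47,
    76, 42, 72, 71, 77, 59, 64, 81, 56, 55, 75, 62, 70, 83, 57, 79, 65, 43, 46, 85, 60, 78, 67,
    61, 58, 54, 53, 66], [62, 71, 81, 64, 84, 50, 51, 55, 86, 79, 43, 80, 58, 49, 65, 56, 85, 48,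
    78, 52, 74, 72, 76, 83, 54, 47, 45, 69, 53, 40, 68, 66, 70, 44, 42, 60, 63, 61, 82], [66, 78,
    61, 60, 58, 48, 74, 51, 73, 72, 42, 46, 71, 63, 76, 50, 70, 69, 75, 81, 83, 84, 45, 59, 82,
    77, 86, 40, 85, 65, 79, 80, 43, 53, 52, 64, 67, 68], [43, 40, 68, 48, 44, 46, 60, 86, 81, 55,
    70, 75, 78, 59, 62, 69, 58, 72, 52, 42, 49, 73, 50, 79, 41, 82, 84, 65, 76, 54, 56, 85, 57,
    53, 63, 67, 83], [59, 50, 72, 42, 71, 49, 58, 73, 41, 51, 82, 80, 83, 61, 67, 44, 86, 60, 57,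
    85, 66, 76, 74, 75, 68, 63, 48, 70, 45, 46, 77, 55, 62, 56, 64, 84], [51, 60, 78, 63, 71, 80,
    83, 77, 50, 44, 41, 57, 58, 72, 48, 67, 68, 65, 54, 79, 62, 49, 85, 43, 76, 81, 56, 74, 53,
    42, 69, 66, 47, 55, 86], [69, 56, 47, 78, 81, 80, 83, 43, 57, 79, 70, 55, 58, 41, 40, 45, 71,
    73, 82, 64, 48, 62, 44, 52, 86, 53, 85, 77, 59, 72, 61, 54, 66, 76], [59, 61, 77, 76, 54, 70,
    85, 65, 47, 73, 63, 68, 55, 43, 40, 41, 81, 62, 78, 42, 53, 64, 82, 79, 75, 56, 67, 74, 86,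
    51, 66, 57, 80], [58, 67, 46, 50, 47, 79, 80, 64, 43, 49, 66, 54, 68, 83, 73, 41, 76, 82, 45,
    57, 84, 81, 53, 63, 52, 61, 62, 70, 69, 65, 75, 77], [66, 43, 85, 49, 64, 70, 75, 54, 81, 50,
    67, 82, 42, 79, 44, 57, 72, 51, 78, 83, 86, 77, 45, 80, 52, 40, 41, 65, 60, 69, 84], [55, 74,
    72, 45, 58, 42, 63, 68, 62, 43, 69, 48, 56, 40, 50, 53, 41, 83, 54, 46, 44, 84, 59, 57, 47,
    75, 65, 73, 79, 81], [60, 45, 65, 41, 69, 85, 75, 44, 42, 70, 49, 50, 48, 40, 61, 56, 82, 66,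
    59, 64, 52, 84, 83, 68, 77, 57, 54, 67, 78], [78, 82, 46, 49, 41, 53, 56, 70, 61, 66, 63, 64,
    55, 69, 40, 44, 52, 51, 57, 79, 77, 76, 71, 48, 62, 68, 67, 86], [60, 56, 86, 69, 67, 54, 73,
    51, 79, 52, 66, 85, 63, 64, 40, 75, 71, 62, 74, 81, 84, 82, 43, 50, 61, 58, 68], [84, 44, 78,
    86, 71, 40, 59, 67, 77, 57, 75, 74, 73, 72, 61, 83, 56, 49, 41, 68, 55, 47, 63, 62, 69, 66],
    [76, 53, 52, 59, 63, 74, 43, 66, 77, 42, 47, 62, 61, 78, 68, 54, 64, 50, 69, 51, 40, 55, 67,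
    86, 85], [52, 66, 74, 82, 85, 54, 84, 53, 68, 40, 77, 55, 56, 72, 83, 43, 46, 81, 61, 51, 59,
    58, 62, 67], [47, 45, 46, 48, 75, 40, 82, 84, 66, 67, 68, 62, 55, 60, 42, 72, 71, 49, 74, 51,
    65, 64, 86], [79, 83, 54, 41, 82, 69, 48, 45, 43, 64, 57, 70, 42, 40, 73, 65, 60, 46, 56, 72,
    84, 80], [80, 73, 86, 43, 63, 52, 49, 55, 46, 40, 57, 51, 61, 42, 75, 41, 65, 60, 81, 84, 85],
    [62, 56, 53, 72, 59, 79, 86, 65, 71, 64, 68, 47, 75, 50, 45, 66, 57, 61, 84, 85], [84, 55, 60,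
    81, 71, 58, 47, 79, 42, 80, 41, 83, 44, 66, 45, 65, 50, 64, 77], [78, 70, 72, 57, 44, 76, 77,
    85, 82, 80, 62, 59, 73, 71, 51, 69, 64, 61], [46, 64, 44, 80, 70, 81, 74, 45, 60, 61, 58, 76,
    49, 68, 59, 69, 67], [56, 58, 83, 52, 42, 75, 61, 50, 43, 45, 80, 68, 59, 55, 86, 79], [41,
    61, 63, 74, 65, 69, 71, 47, 43, 86, 67, 46, 53, 60, 78], [75, 84, 55, 80, 43, 51, 70, 42, 65,
    85, 52, 67, 77, 86], [60, 46, 54, 50, 66, 65, 72, 81, 76, 68, 59, 84, 85], [80, 66, 74, 73,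
    67, 86, 50, 81, 69, 59, 56, 58], [47, 58, 67, 48, 85, 70, 73, 60, 53, 63, 76], [41, 77, 78,
    73, 69, 56, 49, 48, 67, 62], [59, 76, 55, 75, 63, 67, 84, 78, 73], [86, 62, 57, 78, 48, 55,
    69, 83], [63, 53, 64, 69, 57, 68, 82], [64, 79, 66, 49, 60, 82], [84, 56, 63, 78, 83], [60,
    58, 59, 83], [64, 77, 47, 45, 69, 53, 56, 66, 61, 54, 58, 65, 60, 63, 68, 80, 73, 83, 86, 79,
    82, 81, 85], [60, 76, 65, 61, 62, 48, 63, 52, 54, 58, 67, 57, 69, 68, 75, 77, 84, 83, 81, 79,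
    82, 86], [55, 47, 58, 48, 69, 51, 56, 68, 62, 61, 67, 65, 66, 74, 83, 86, 79, 85, 78, 84, 82],
    [67, 68, 58, 50, 64, 65, 53, 61, 62, 60, 63, 69, 81, 79, 82, 80, 85, 77, 83, 86], [72, 84, 80,
    71, 74, 81, 85, 73, 70, 76, 78, 83, 79, 86], [86, 70, 76, 79, 77, 81, 73, 82, 74, 78, 85, 71,
    80, 75, 84], [78, 76, 85, 83, 80, 75, 72, 84, 81, 71, 79, 74, 77, 82], [82, 75, 73, 83, 81,
    74, 77, 78, 84, 72, 86, 85, 76, 80], [85, 73, 75, 86, 77, 82, 83, 78, 79, 84, 81, 76, 74, 80],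
    [77, 72, 85, 71, 79, 73, 84, 86, 70, 81, 75, 83], [73, 81, 74, 70, 84, 78, 80, 72, 86, 71, 82,
    85], [78, 84, 81, 76, 71, 75, 72, 70, 80, 82, 86], [71, 74, 79, 80, 75, 82, 85, 86, 84], [78,
    80, 71, 79, 82, 86, 76, 83, 74, 84, 81], [82, 76, 70, 74, 71, 79, 85, 80, 86], [70, 73, 86,
    84, 79, 75, 76, 71, 77, 83, 72], [72, 75, 78, 74, 83, 82, 84, 85, 86], [78, 72, 84, 77, 81,
    83, 85], [80, 86, 81, 79, 77, 82, 85, 83, 76], [83, 85, 76, 73, 82, 81], [86, 75, 77, 85, 73,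
    83, 72, 80], [71, 70, 82, 74, 85, 76, 75, 77], [82, 80, 70, 81, 86], [77, 83, 86, 81, 85],
    [83, 84, 78, 76], [74, 79, 78], [80, 78], [73, 74, 81, 82], [71, 80], [79, 85, 84]]

theorem isBicolouredTable_fourColoured87 :
    isBicolouredTable [40, 4, 26, 17] 87 (tableOf 87 fourColoured87.flatten) = true := by
  decide +kernel

/-! ### The 5-bicoloured systems, of orders 51, 55, 63, 67, 75, 79 and 87. -/

/-- Third points of a 5-bicoloured Steiner triple system of order 51 with colour classes of
sizes 24, 2, 16, 8 and 1, one row for each smallest point. -/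
def fiveColoured51 : List (List ℕ) :=
  [[48, 43, 46, 26, 42, 34, 41, 24, 39, 28, 25, 49, 32, 47, 30, 50, 27, 45, 40, 44, 36, 38, 31,
    33, 37], [39, 26, 45, 30, 31, 40, 41, 49, 50, 29, 47, 24, 38, 43, 35, 25, 44, 34, 32, 46, 42,
    33, 37, 36], [36, 32, 47, 38, 46, 49, 41, 24, 42, 28, 27, 29, 33, 37, 48, 40, 25, 50, 34, 45,
    44, 35, 31], [38, 35, 45, 50, 30, 44, 25, 24, 39, 37, 48, 32, 43, 28, 29, 27, 42, 41, 49, 47,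
    34, 40], [34, 27, 44, 46, 29, 40, 28, 42, 39, 41, 37, 25, 50, 35, 48, 47, 43, 24, 49, 36, 33],
    [32, 25, 36, 43, 27, 49, 31, 38, 24, 50, 48, 44, 33, 26, 41, 29, 37, 28, 40, 46], [49, 44, 48,
    41, 50, 24, 30, 36, 25, 33, 35, 47, 43, 46, 26, 39, 42, 29, 40], [26, 30, 39, 47, 45, 35, 31,
    27, 36, 24, 28, 32, 37, 33, 48, 29, 38, 43], [37, 48, 32, 43, 25, 35, 45, 40, 33, 50, 42, 39,
    47, 28, 34, 29, 38], [46, 31, 33, 50, 42, 28, 45, 38, 36, 24, 27, 25, 47, 40, 32, 35], [44,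
    35, 47, 32, 34, 38, 49, 43, 33, 36, 30, 29, 37, 31, 45], [27, 36, 37, 48, 34, 30, 39, 35, 45,
    40, 43, 46, 33, 41], [46, 50, 36, 44, 40, 25, 37, 29, 48, 30, 32, 38, 41], [33, 31, 26, 29,
    42, 49, 34, 44, 41, 45, 40, 48], [39, 28, 45, 26, 44, 25, 27, 40, 43, 34, 49], [42, 46, 38,
    47, 35, 49, 44, 24, 40, 41], [47, 24, 41, 49, 31, 46, 39, 32, 30], [34, 36, 43, 42, 31, 26,
    39, 41], [46, 31, 37, 27, 41, 32, 49], [28, 45, 50, 38, 31, 39], [24, 26, 48, 33, 40], [32,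
    50, 35, 39], [25, 34, 36], [36, 35], [50, 29, 31, 37, 41, 38, 39, 36, 40, 46, 49, 45, 48],
    [27, 30, 39, 36, 34, 35, 38, 41, 49, 44, 48, 47], [42, 49, 47, 45, 48, 50, 44, 46], [44, 46,
    49, 43, 47, 42, 45, 50, 48], [43, 48, 50, 49, 47, 46, 45], [44, 50, 45, 48, 49, 46, 43, 47],
    [42, 50, 45, 47, 48], [49, 50, 46, 44, 48, 42, 47], [45, 42, 47, 43, 46, 50], [46, 44, 43, 47,
    48], [45, 48, 42, 46], [48, 43, 46, 49], [50, 44, 42, 49, 43], [47], [49], [49], [47], [50],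
    [50], [50], [50]]

/-- A class of size 1 is allowed: strictness asks only that each colour be used. Here 24 + 2 = (51 +
1) / 2. -/
theorem isBicolouredTable_fiveColoured51 :
    isBicolouredTable [24, 2, 16, 8, 1] 51 (tableOf 51 fiveColoured51.flatten) = true := by
  decide +kernel

/-- Third points of a 5-bicoloured Steiner triple system of order 55 with colour classes of
sizes 20, 8, 24, 2 and 1, one row for each smallest point. -/
def fiveColoured55 : List (List ℕ) :=
  [[47, 49, 25, 38, 46, 21, 40, 35, 29, 30, 27, 23, 22, 20, 54, 26, 52, 24, 53, 32, 45, 42, 51,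
    39, 50, 43, 48], [54, 30, 53, 35, 27, 43, 44, 50, 36, 21, 20, 38, 41, 46, 22, 25, 52, 24, 26,
    45, 34, 33, 40, 42, 48, 51], [53, 30, 33, 24, 27, 32, 22, 38, 48, 52, 34, 44, 31, 20, 50, 26,
    23, 25, 35, 43, 40, 46, 51, 45, 47], [23, 26, 39, 35, 42, 47, 24, 54, 46, 31, 45, 52, 27, 49,
    36, 21, 22, 40, 38, 51, 44, 37, 50, 48], [39, 54, 20, 21, 48, 37, 32, 49, 24, 52, 27, 25, 44,
    22, 26, 47, 41, 36, 35, 45, 51, 46, 50], [45, 23, 24, 41, 53, 20, 27, 25, 21, 22, 52, 43, 54,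
    38, 37, 30, 40, 48, 49, 50, 51, 47], [32, 34, 46, 52, 53, 26, 50, 33, 25, 47, 20, 37, 40, 23,
    44, 48, 38, 51, 41, 43, 49], [52, 53, 54, 22, 24, 37, 26, 21, 33, 48, 25, 39, 42, 51, 31, 44,
    41, 49, 46, 50], [40, 47, 30, 22, 53, 50, 26, 23, 27, 29, 54, 25, 31, 41, 46, 39, 43, 49, 51],
    [20, 26, 21, 44, 34, 23, 28, 54, 27, 52, 25, 51, 38, 42, 39, 37, 45, 49], [39, 25, 51, 22, 49,
    21, 31, 23, 28, 27, 46, 34, 45, 42, 43, 44, 50], [51, 52, 25, 24, 43, 23, 33, 42, 29, 34, 50,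
    49, 40, 45, 47, 46], [45, 54, 29, 37, 53, 31, 41, 34, 33, 35, 38, 50, 44, 48, 47], [43, 36,
    54, 26, 20, 27, 23, 48, 42, 49, 33, 40, 47, 46], [53, 24, 35, 51, 29, 27, 49, 36, 32, 48, 40,
    42, 47], [42, 41, 28, 20, 34, 47, 37, 45, 50, 44, 48, 51], [40, 53, 34, 36, 44, 35, 50, 39,
    48, 51, 49], [21, 51, 24, 30, 45, 38, 46, 39, 42, 47], [32, 41, 35, 44, 46, 47, 43, 48, 50],
    [25, 43, 50, 49, 36, 44, 47, 48], [53, 52, 48, 42, 54, 51, 32, 37, 41, 38, 36, 43, 45, 46, 50,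
    49], [54, 52, 36, 45, 33, 44, 42, 37, 49, 50, 51, 41, 40, 46, 48], [52, 53, 36, 39, 46, 49,
    44, 48, 42, 47, 38, 50, 51, 45], [53, 54, 38, 33, 50, 42, 45, 46, 39, 37, 41, 44, 51, 49],
    [54, 28, 31, 35, 36, 51, 40, 49, 47, 43, 42, 45, 50], [53, 52, 41, 49, 48, 46, 39, 47, 43, 38,
    44, 45, 42, 51], [43, 37, 32, 39, 50, 47, 48, 46, 45, 49, 51], [47, 40, 48, 43, 36, 38, 44,
    41, 49, 50, 51], [53, 54, 52], [52, 54, 53], [54, 52, 53], [53, 54, 52], [53, 54, 52], [52,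
    53, 54], [53, 54], [53, 54], [54, 53, 52], [52, 54], [54, 52, 53], [52], [52], [52, 53], [53],
    [54], [54]]

theorem isBicolouredTable_fiveColoured55 :
    isBicolouredTable [20, 8, 24, 2, 1] 55 (tableOf 55 fiveColoured55.flatten) = true := by
  decide +kernel

/-- Third points of a 5-bicoloured Steiner triple system of order 63 with colour classes of
sizes 30, 2, 20, 6 and 5, one row for each smallest point. -/
def fiveColoured63 : List (List ℕ) :=
  [[48, 37, 56, 62, 47, 33, 39, 49, 36, 42, 31, 34, 61, 55, 54, 50, 59, 30, 35, 41, 60, 44, 46,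
    45, 57, 53, 38, 52, 58, 40, 51], [47, 54, 50, 52, 39, 43, 62, 41, 45, 49, 55, 33, 34, 56, 60,
    31, 53, 30, 35, 46, 37, 32, 61, 59, 58, 42, 36, 57, 40, 51], [61, 41, 39, 53, 33, 40, 56, 54,
    34, 50, 57, 45, 38, 58, 46, 42, 51, 32, 55, 59, 60, 49, 31, 62, 44, 30, 52, 48, 43], [58, 30,
    47, 57, 46, 39, 62, 37, 40, 35, 31, 36, 42, 55, 52, 32, 33, 44, 60, 49, 50, 38, 51, 53, 59,
    43, 41, 48], [46, 38, 48, 45, 31, 57, 61, 39, 44, 53, 47, 56, 49, 35, 43, 52, 59, 54, 42, 37,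
    30, 55, 60, 51, 40, 34, 36], [31, 32, 33, 60, 53, 59, 58, 54, 42, 51, 45, 50, 40, 56, 38, 62,
    61, 41, 48, 55, 57, 36, 49, 44, 35, 43], [40, 43, 50, 37, 55, 49, 30, 62, 57, 59, 36, 60, 58,
    54, 56, 35, 44, 52, 46, 61, 32, 48, 42, 45, 51], [52, 47, 31, 56, 59, 38, 60, 45, 41, 30, 54,
    55, 61, 53, 50, 37, 62, 51, 35, 58, 34, 36, 49, 46], [37, 60, 48, 51, 34, 57, 42, 38, 54, 56,
    36, 39, 50, 55, 31, 35, 58, 30, 59, 53, 61, 47, 44], [35, 57, 42, 55, 43, 30, 62, 40, 34, 38,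
    53, 52, 58, 61, 54, 44, 59, 33, 45, 48, 49, 51], [43, 47, 49, 61, 39, 52, 44, 58, 59, 48, 51,
    32, 33, 41, 56, 34, 55, 40, 30, 46, 50], [46, 47, 36, 50, 30, 53, 51, 33, 45, 35, 38, 58, 44,
    39, 52, 54, 62, 60, 41, 42], [53, 30, 60, 54, 45, 48, 62, 31, 61, 36, 57, 43, 32, 37, 52, 33,
    56, 44, 41], [58, 41, 37, 56, 46, 52, 62, 48, 51, 36, 59, 43, 60, 31, 50, 32, 40, 45], [46,
    49, 51, 59, 40, 56, 33, 52, 48, 47, 50, 38, 41, 32, 54, 37, 44], [55, 37, 49, 61, 44, 58, 62,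
    35, 53, 52, 32, 34, 31, 59, 48, 43], [34, 31, 53, 47, 32, 57, 40, 39, 36, 44, 46, 61, 51, 35,
    48], [32, 57, 60, 38, 48, 52, 58, 35, 47, 61, 39, 62, 43, 42], [44, 57, 45, 39, 62, 55, 61,
    41, 47, 43, 37, 50, 38], [37, 54, 42, 50, 31, 60, 48, 39, 47, 41, 46, 49], [34, 43, 59, 30,
    42, 36, 51, 58, 55, 49, 50], [30, 43, 42, 41, 49, 40, 57, 31, 39, 47], [34, 40, 53, 31, 56,
    41, 45, 49, 47], [56, 45, 54, 30, 55, 53, 51, 47], [33, 46, 57, 60, 38, 36, 51], [40, 62, 54,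
    34, 48, 49], [43, 56, 33, 45, 50], [35, 49, 45, 50], [46, 42, 44], [39, 50], [60, 39, 44, 42,
    50, 47, 49, 45, 46, 43, 51, 53, 56, 57, 61, 62], [48, 37, 36, 38, 42, 51, 50, 44, 47, 49, 56,
    55, 57, 62, 61], [59, 57, 58, 61, 62, 56, 60, 55, 52, 54, 53], [62, 58, 57, 60, 56, 61, 52,
    55, 53, 54], [53, 55, 58, 56, 54, 59, 57, 60, 61, 52], [60, 55, 54, 59, 62, 53, 56, 52, 58,
    61], [62, 59, 61, 53, 52, 54, 56, 57, 55, 58], [56, 54, 52, 60, 55, 59, 61, 57], [60, 54, 52,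
    57, 59, 62, 53], [55, 53, 61, 59, 56, 62, 52], [62, 61, 58, 54, 53, 57], [59, 53, 58, 57, 52],
    [57, 56, 58, 60, 52, 55], [61, 60, 55, 59, 58], [57, 62, 58, 54, 53], [62, 56, 60], [54], [61,
    56], [55], [60, 62], [59], [61, 58, 59, 62], [59, 62, 58, 61], [62, 60], [61, 60], [60, 59],
    [62]]

theorem isBicolouredTable_fiveColoured63 :
    isBicolouredTable [30, 2, 20, 6, 5] 63 (tableOf 63 fiveColoured63.flatten) = true := by
  decide +kernel

/-- Third points of a 5-bicoloured Steiner triple system of order 67 with colour classes of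
sizes 32, 2, 16, 16 and 1, one row for each smallest point. -/
def fiveColoured67 : List (List ℕ) :=
  [[33, 54, 49, 50, 40, 59, 65, 42, 39, 37, 66, 47, 62, 61, 35, 57, 53, 34, 60, 46, 64, 55, 48,
    41, 36, 43, 51, 32, 63, 52, 45, 44, 58], [38, 39, 34, 55, 64, 52, 35, 32, 66, 57, 58, 44, 50,
    37, 63, 51, 49, 42, 36, 45, 65, 40, 61, 48, 56, 46, 41, 60, 54, 53, 47, 62], [65, 58, 36, 50,
    37, 51, 53, 64, 40, 55, 34, 39, 45, 59, 32, 43, 33, 35, 61, 47, 41, 56, 52, 48, 57, 63, 66,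
    46, 42, 49, 62], [62, 42, 35, 54, 32, 60, 45, 38, 40, 57, 43, 50, 48, 47, 52, 59, 37, 44, 56,
    53, 34, 41, 51, 58, 33, 61, 66, 63, 46, 64], [47, 56, 39, 53, 66, 63, 43, 61, 46, 60, 44, 33,
    38, 32, 35, 40, 65, 54, 52, 36, 51, 55, 42, 45, 59, 57, 64, 41, 49], [34, 32, 62, 35, 57, 53,
    59, 33, 63, 54, 39, 65, 38, 64, 45, 52, 43, 46, 50, 37, 66, 44, 51, 56, 60, 49, 48, 61], [53,
    40, 33, 62, 36, 46, 49, 38, 41, 66, 44, 55, 65, 57, 60, 51, 42, 52, 45, 58, 37, 47, 43, 32,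
    54, 48, 63], [60, 47, 34, 55, 43, 64, 41, 58, 46, 57, 63, 51, 38, 56, 62, 35, 66, 61, 33, 50,
    59, 49, 40, 44, 48, 45], [56, 47, 33, 39, 50, 59, 63, 55, 41, 61, 52, 65, 46, 49, 37, 38, 64,
    54, 43, 66, 57, 44, 58, 36, 48], [48, 58, 63, 36, 49, 34, 45, 54, 41, 61, 59, 37, 57, 55, 65,
    43, 46, 40, 52, 64, 62, 38, 44, 51], [51, 32, 65, 33, 52, 54, 43, 56, 58, 49, 53, 60, 44, 42,
    38, 59, 61, 39, 40, 36, 46, 41, 55], [45, 42, 46, 47, 64, 39, 54, 44, 48, 41, 52, 50, 32, 59,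
    35, 34, 49, 62, 61, 37, 60, 65], [60, 62, 36, 65, 48, 53, 56, 51, 57, 41, 33, 44, 66, 49, 64,
    35, 37, 42, 50, 38, 54], [56, 59, 61, 52, 48, 53, 66, 55, 32, 47, 35, 58, 37, 45, 43, 54, 39,
    41, 40, 63], [51, 58, 40, 65, 36, 52, 54, 37, 32, 48, 35, 44, 55, 57, 34, 45, 66, 47, 64],
    [40, 55, 33, 43, 53, 39, 42, 49, 46, 65, 38, 66, 62, 32, 48, 56, 64, 61], [62, 50, 32, 42, 36,
    44, 51, 37, 60, 41, 38, 53, 35, 56, 52, 47, 49], [66, 37, 56, 58, 33, 60, 64, 46, 50, 36, 34,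
    42, 35, 61, 49, 63], [39, 60, 62, 36, 64, 47, 57, 42, 59, 37, 44, 58, 51, 45, 46], [41, 40,
    66, 45, 57, 63, 34, 49, 54, 50, 55, 62, 47, 48], [50, 39, 61, 58, 34, 32, 54, 55, 33, 63, 47,
    44, 64], [38, 66, 33, 47, 63, 32, 42, 51, 59, 48, 43, 49], [59, 63, 50, 61, 35, 46, 48, 64,
    34, 45, 58], [43, 54, 57, 63, 58, 36, 38, 65, 39, 62], [53, 62, 39, 40, 45, 49, 55, 60, 59],
    [40, 62, 56, 55, 33, 32, 44, 49], [60, 64, 65, 47, 36, 45, 53], [48, 47, 41, 33, 56, 65], [38,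
    50, 60, 44, 65], [53, 39, 46, 58], [43, 37, 65], [40, 59], [66, 35, 41, 39, 45, 47, 43, 48,
    49, 53, 55, 62, 64, 59, 61, 63, 65], [49, 36, 40, 39, 47, 46, 48, 45, 57, 61, 64, 56, 62, 63,
    65, 60], [66, 63, 53, 57, 51, 56, 65, 52, 61, 62, 59, 64], [63, 66, 64, 59, 55, 58, 52, 62,
    53, 61, 56, 60, 65], [56, 63, 54, 57, 64, 50, 53, 65, 66, 52, 60, 62, 61], [64, 57, 66, 60,
    59, 61, 54, 62, 52, 65, 58, 55], [60, 52, 62, 51, 58, 65, 59, 61, 55, 57], [59, 50, 60, 56,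
    65, 66, 58, 53, 57, 61, 63], [62, 61, 58, 56, 51, 55, 64, 65, 60, 63], [51, 53, 61, 66, 64,
    59, 58, 57, 65], [66, 54, 58, 63, 65], [60, 54, 64, 61, 63, 65], [66, 55, 62, 59, 63, 54, 65],
    [63, 52, 58, 56, 65, 62, 64], [50, 62, 59, 60, 64], [61, 59, 57, 63, 64, 60], [63, 60, 57, 56,
    64], [56, 54, 57, 63, 62], [66], [66], [66], [66], [66], [66], [66], [66]]

theorem isBicolouredTable_fiveColoured67 :
    isBicolouredTable [32, 2, 16, 16, 1] 67 (tableOf 67 fiveColoured67.flatten) = true := by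
  decide +kernel

/-- Third points of a 5-bicoloured Steiner triple system of order 75 with colour classes of
sizes 28, 10, 32, 4 and 1, one row for each smallest point. -/
def fiveColoured75 : List (List ℕ) :=
  [[41, 34, 32, 48, 51, 69, 35, 59, 49, 70, 74, 28, 72, 55, 37, 64, 33, 71, 44, 58, 45, 40, 30,
    66, 73, 36, 38, 31, 42, 67, 61, 50, 65, 63, 56, 60, 68], [73, 59, 32, 46, 33, 28, 58, 43, 71,
    50, 74, 34, 35, 49, 72, 55, 52, 64, 60, 68, 57, 70, 67, 36, 30, 29, 37, 40, 53, 62, 69, 48,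
    66, 63, 61, 65], [29, 52, 47, 37, 45, 32, 50, 65, 31, 33, 28, 71, 43, 66, 62, 30, 40, 53, 60,
    38, 74, 70, 55, 67, 72, 36, 44, 48, 58, 57, 64, 68, 59, 69, 63], [67, 31, 36, 34, 37, 63, 41,
    55, 40, 35, 70, 30, 45, 61, 43, 33, 73, 28, 72, 71, 74, 66, 64, 48, 51, 69, 57, 56, 52, 49,
    65, 62, 60, 68], [73, 57, 70, 74, 34, 72, 47, 66, 50, 58, 40, 33, 71, 41, 46, 65, 35, 37, 31,
    29, 63, 38, 28, 36, 54, 55, 60, 61, 56, 51, 59, 64, 69], [65, 57, 36, 28, 32, 70, 50, 71, 69,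
    58, 44, 63, 35, 34, 38, 30, 74, 64, 72, 29, 37, 33, 45, 43, 62, 56, 54, 68, 61, 66, 59, 67],
    [53, 38, 73, 59, 54, 32, 29, 34, 70, 56, 28, 64, 47, 74, 63, 67, 35, 49, 71, 72, 39, 31, 45,
    68, 46, 50, 58, 55, 60, 62, 66], [46, 66, 51, 49, 48, 30, 72, 29, 71, 74, 33, 32, 54, 31, 36,
    73, 64, 37, 61, 40, 69, 65, 50, 68, 52, 47, 56, 62, 67, 63], [62, 42, 28, 34, 73, 29, 54, 31,
    49, 61, 71, 33, 72, 66, 39, 30, 35, 44, 70, 67, 47, 63, 60, 52, 64, 55, 57, 68, 69], [68, 32,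
    36, 59, 54, 47, 30, 72, 69, 29, 71, 42, 70, 40, 48, 58, 74, 61, 33, 37, 39, 51, 67, 65, 56,
    53, 60, 64], [33, 30, 53, 31, 28, 43, 37, 29, 74, 36, 62, 73, 63, 58, 52, 69, 46, 35, 66, 64,
    56, 60, 49, 61, 57, 55, 67], [65, 56, 30, 48, 36, 29, 73, 72, 35, 71, 34, 60, 37, 62, 41, 43,
    63, 59, 64, 51, 66, 67, 53, 68, 69, 61], [55, 37, 69, 70, 31, 72, 60, 57, 29, 35, 44, 73, 56,
    71, 59, 49, 52, 64, 54, 53, 47, 62, 58, 68, 67], [51, 74, 42, 41, 37, 31, 32, 33, 44, 67, 36,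
    48, 70, 45, 60, 58, 54, 47, 64, 69, 66, 68, 65, 63], [62, 32, 73, 28, 50, 63, 36, 42, 68, 33,
    49, 52, 74, 57, 67, 66, 44, 59, 53, 47, 65, 60, 64], [51, 56, 36, 73, 39, 41, 33, 72, 71, 34,
    32, 57, 35, 52, 61, 53, 63, 50, 64, 66, 65, 68], [47, 74, 57, 68, 73, 39, 69, 35, 59, 28, 37,
    34, 50, 41, 54, 67, 65, 63, 58, 61, 62], [42, 36, 70, 52, 54, 34, 39, 53, 35, 67, 32, 44, 46,
    65, 51, 59, 60, 58, 68, 69], [45, 50, 39, 68, 32, 31, 70, 34, 51, 58, 60, 54, 49, 62, 53, 67,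
    57, 63, 66], [42, 70, 30, 37, 53, 28, 55, 35, 65, 66, 61, 68, 49, 67, 54, 63, 59, 69], [37,
    52, 46, 34, 72, 29, 31, 30, 44, 67, 49, 69, 55, 61, 62, 59, 66], [32, 61, 65, 74, 53, 34, 67,
    57, 51, 59, 58, 56, 64, 55, 66, 69], [29, 62, 51, 65, 71, 31, 58, 46, 64, 59, 50, 63, 56, 69,
    61], [28, 43, 33, 36, 41, 45, 52, 58, 53, 62, 59, 65, 57, 66], [61, 56, 32, 47, 42, 60, 44,
    55, 69, 51, 59, 68, 63], [31, 30, 33, 64, 41, 47, 67, 68, 57, 65, 54, 69], [73, 62, 50, 60,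
    57, 58, 66, 54, 51, 59, 68], [66, 52, 62, 69, 54, 63, 60, 68, 58, 65], [72, 73, 38, 74, 71,
    70, 60, 68, 52, 57, 66, 45, 48, 55, 51, 58, 53, 62, 64, 61, 69, 67], [60, 74, 46, 73, 71, 70,
    61, 50, 68, 69, 49, 62, 57, 66, 53, 56, 54, 67, 63, 65, 64], [68, 71, 74, 73, 55, 47, 48, 49,
    59, 61, 45, 51, 67, 64, 69, 63, 62, 65, 66, 72], [72, 73, 74, 62, 46, 61, 45, 48, 54, 55, 68,
    66, 58, 53, 57, 67, 69, 64, 65, 71], [56, 70, 47, 71, 68, 40, 43, 63, 65, 62, 48, 67, 69, 52,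
    54, 66, 61, 64, 60], [70, 72, 54, 74, 60, 53, 56, 43, 51, 59, 65, 63, 61, 57, 55, 69, 66, 67,
    73], [45, 72, 59, 57, 58, 52, 50, 64, 46, 63, 66, 60, 69, 68, 55, 67, 65], [45, 63, 51, 53,
    69, 55, 50, 67, 64, 62, 52, 58, 61, 59, 66, 68], [44, 56, 51, 65, 59, 64, 66, 63, 68, 50, 69,
    55, 67, 60, 62, 73], [48, 49, 63, 42, 69, 68, 59, 57, 56, 66, 58, 61, 64, 65, 67], [70, 71,
    74, 73, 72], [72, 74, 70, 73, 71], [70, 71, 74, 72, 73], [73, 74, 72, 71, 70], [73, 71, 72,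
    74], [73, 70, 74], [71, 70, 72, 74], [71, 70, 74, 73, 72], [70, 72], [70, 72, 74, 73], [72,
    71], [74, 72, 73], [72, 71, 73, 74], [72, 74, 70, 71, 73], [71, 73], [70, 71, 74], [70, 71],
    [73, 74], [71, 73], [70, 71], [70, 72, 73], [71], [74], [73, 74], [72], [72, 70], [70], [74],
    [74]]

theorem isBicolouredTable_fiveColoured75 :
    isBicolouredTable [28, 10, 32, 4, 1] 75 (tableOf 75 fiveColoured75.flatten) = true := by
  decide +kernel

/-- Third points of a 5-bicoloured Steiner triple system of order 79 with colour classes of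
sizes 24, 16, 36, 2 and 1, one row for each smallest point. -/
def fiveColoured79 : List (List ℕ) :=
  [[63, 32, 54, 38, 35, 77, 28, 33, 75, 71, 76, 24, 50, 39, 31, 74, 64, 78, 65, 37, 30, 45, 60,
    36, 29, 34, 41, 57, 55, 49, 67, 66, 58, 70, 59, 72, 69, 62, 73], [47, 72, 77, 31, 76, 29, 55,
    60, 24, 52, 26, 44, 35, 71, 64, 70, 32, 78, 25, 51, 34, 74, 33, 38, 39, 37, 67, 59, 58, 65,
    62, 61, 73, 68, 56, 69, 57, 75], [25, 66, 57, 34, 73, 53, 29, 76, 65, 78, 77, 38, 36, 59, 24,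
    28, 39, 31, 72, 46, 50, 37, 30, 35, 43, 60, 63, 75, 58, 64, 67, 69, 54, 61, 62, 71, 74], [44,
    61, 27, 67, 77, 56, 34, 33, 68, 53, 30, 28, 36, 37, 24, 31, 46, 62, 78, 76, 39, 38, 35, 65,
    47, 66, 75, 49, 57, 69, 55, 74, 70, 71, 73, 64], [37, 33, 56, 61, 51, 68, 50, 25, 34, 76, 72,
    35, 78, 70, 24, 28, 27, 47, 36, 31, 39, 32, 53, 48, 43, 63, 71, 55, 67, 64, 58, 60, 69, 74,
    75], [63, 76, 58, 55, 38, 77, 64, 27, 26, 78, 67, 34, 42, 28, 30, 33, 32, 29, 25, 39, 68, 70,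
    56, 50, 69, 60, 74, 65, 71, 59, 73, 54, 66, 75], [37, 31, 30, 58, 36, 39, 35, 29, 24, 78, 60,
    43, 42, 70, 25, 26, 28, 38, 61, 67, 66, 48, 72, 55, 65, 75, 52, 71, 74, 68, 62, 64, 73], [57,
    35, 54, 63, 30, 25, 78, 41, 52, 31, 34, 74, 77, 70, 33, 27, 26, 36, 39, 59, 65, 66, 51, 55,
    69, 48, 53, 58, 71, 64, 72, 75], [78, 30, 49, 52, 24, 37, 76, 56, 29, 39, 26, 65, 38, 73, 25,
    28, 34, 36, 72, 66, 68, 64, 59, 67, 75, 69, 54, 60, 74, 70, 71], [77, 25, 27, 32, 43, 34, 33,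
    47, 45, 76, 26, 24, 36, 39, 37, 38, 66, 49, 69, 62, 54, 50, 70, 59, 73, 61, 65, 74, 71, 72],
    [27, 35, 78, 36, 32, 25, 26, 33, 37, 29, 39, 28, 31, 42, 53, 52, 61, 73, 50, 67, 51, 63, 70,
    65, 64, 75, 62, 72, 74], [67, 37, 68, 45, 38, 30, 58, 29, 32, 44, 39, 78, 31, 28, 35, 74, 71,
    53, 72, 70, 56, 60, 57, 69, 64, 73, 66, 75], [71, 58, 33, 29, 28, 77, 32, 38, 76, 31, 37, 36,
    57, 51, 72, 49, 53, 46, 54, 75, 74, 63, 66, 62, 65, 69, 73], [40, 74, 65, 51, 76, 73, 39, 43,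
    29, 26, 33, 38, 36, 57, 52, 56, 63, 61, 66, 69, 72, 59, 68, 67, 64, 75], [27, 28, 25, 31, 48,
    54, 34, 77, 24, 33, 44, 51, 71, 55, 50, 59, 75, 64, 73, 72, 74, 65, 63, 70, 69], [53, 77, 60,
    38, 35, 64, 61, 62, 29, 30, 39, 73, 56, 67, 68, 66, 57, 63, 51, 55, 65, 58, 70, 75], [32, 75,
    41, 34, 26, 76, 77, 30, 37, 39, 46, 71, 73, 63, 54, 72, 69, 61, 70, 66, 60, 68, 62], [36, 54,
    76, 48, 35, 75, 39, 38, 55, 69, 50, 44, 72, 65, 66, 57, 56, 73, 63, 74, 71, 68], [30, 27, 59,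
    62, 57, 37, 38, 35, 48, 65, 64, 56, 49, 53, 68, 69, 61, 66, 73, 74, 72], [33, 77, 53, 34, 35,
    36, 52, 63, 45, 59, 68, 70, 62, 67, 57, 75, 64, 61, 71, 72], [78, 67, 69, 36, 62, 75, 60, 61,
    57, 51, 52, 59, 50, 68, 71, 58, 72, 73, 74], [66, 32, 35, 36, 37, 69, 54, 61, 52, 49, 71, 73,
    57, 68, 74, 67, 63, 75], [51, 37, 30, 38, 70, 68, 55, 48, 72, 57, 54, 71, 64, 65, 74, 69, 75],
    [33, 38, 71, 64, 49, 53, 56, 61, 52, 59, 72, 73, 65, 63, 67, 70], [78, 71, 44, 49, 69, 41, 59,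
    76, 77, 63, 64, 46, 65, 62, 56, 67, 54, 72, 70, 74, 75, 60, 73, 68], [76, 45, 62, 55, 72, 68,
    78, 77, 63, 75, 58, 70, 69, 71, 53, 65, 49, 64, 61, 60, 67, 57, 66, 74], [77, 42, 47, 56, 78,
    52, 49, 62, 59, 54, 68, 51, 61, 57, 55, 71, 66, 67, 65, 70, 73, 75], [61, 76, 66, 40, 55, 44,
    60, 57, 63, 71, 75, 59, 62, 64, 58, 65, 70, 73, 69, 74], [59, 40, 46, 77, 76, 43, 78, 61, 73,
    58, 50, 64, 74, 52, 60, 75, 55, 67, 69, 66, 68, 72], [78, 69, 76, 73, 57, 77, 47, 74, 45, 51,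
    64, 62, 72, 66, 68, 63, 56, 67, 75, 70, 71], [48, 77, 49, 76, 55, 50, 59, 70, 46, 60, 73, 53,
    63, 71, 61, 66, 69, 67, 75, 72, 74], [78, 50, 42, 77, 54, 63, 62, 47, 66, 74, 72, 56, 67, 71,
    59, 75, 68, 70, 73], [41, 46, 45, 58, 52, 75, 70, 68, 56, 61, 62, 73, 59, 64, 74, 67, 71],
    [75, 77, 78, 76, 64, 42, 54, 60, 70, 48, 62, 63, 55, 74, 71, 65, 66, 61, 72], [66, 49, 40, 50,
    73, 64, 47, 55, 71, 58, 65, 68, 67, 72, 70, 74, 69], [76, 48, 73, 67, 74, 55, 53, 68, 51, 71,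
    62, 70, 60, 63, 72, 75, 69, 66], [78, 60, 46, 62, 67, 57, 58, 53, 73, 61, 75, 63, 56, 68, 72,
    70, 69, 74], [69, 44, 75, 45, 74, 53, 67, 64, 72, 58, 61, 59, 63, 70, 68, 65, 73], [50, 52,
    46, 71, 48, 75, 60, 65, 73, 66, 58, 59, 74, 72, 68, 70, 67], [72, 54, 68, 69, 47, 56, 51, 53,
    75, 60, 74, 65, 71, 73, 66, 70], [77, 76, 78], [77, 76, 78], [78, 77, 76], [76, 78], [78, 76,
    77], [77, 78], [77, 78, 76], [77], [78, 76], [77, 76, 78], [77, 78, 76], [76, 78], [76], [77,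
    76, 78], [76, 78], [77, 76, 78], [77], [77, 76], [78, 76], [76, 78], [77], [78, 77], [77],
    [77], [77], [78], [76], [78]]

theorem isBicolouredTable_fiveColoured79 :
    isBicolouredTable [24, 16, 36, 2, 1] 79 (tableOf 79 fiveColoured79.flatten) = true := by
  decide +kernel

/-- Third points of a 5-bicoloured Steiner triple system of order 87 with colour classes of
sizes 24, 20, 40, 2 and 1, one row for each smallest point. -/
def fiveColoured87 : List (List ℕ) :=
  [[78, 32, 33, 38, 24, 37, 57, 36, 26, 29, 85, 28, 77, 86, 39, 30, 65, 43, 31, 41, 84, 40, 34,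
    42, 35, 48, 76, 63, 74, 83, 73, 69, 61, 71, 60, 66, 64, 67, 75, 81, 79, 82, 80], [65, 24, 60,
    33, 31, 36, 43, 38, 35, 29, 75, 30, 61, 84, 26, 49, 39, 32, 40, 86, 85, 25, 37, 34, 42, 46,
    70, 51, 53, 52, 69, 81, 71, 73, 80, 74, 76, 64, 79, 72, 83, 82], [86, 85, 83, 28, 42, 51, 67,
    40, 33, 25, 46, 66, 75, 41, 34, 76, 26, 49, 36, 50, 84, 31, 43, 30, 37, 39, 45, 78, 69, 58,
    63, 82, 80, 74, 71, 60, 68, 70, 77, 73, 81], [43, 78, 40, 28, 34, 59, 30, 39, 27, 69, 84, 76,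
    57, 41, 38, 68, 37, 42, 31, 85, 29, 32, 36, 73, 61, 56, 75, 67, 70, 65, 63, 79, 80, 55, 81,
    66, 77, 72, 83, 82], [31, 53, 24, 50, 40, 86, 64, 42, 67, 26, 30, 39, 25, 36, 41, 35, 73, 84,
    27, 33, 32, 37, 55, 79, 48, 57, 77, 68, 74, 61, 81, 62, 63, 80, 69, 83, 75, 76, 82], [85, 84,
    32, 61, 82, 36, 40, 25, 72, 29, 43, 30, 27, 45, 73, 39, 86, 74, 41, 37, 42, 38, 81, 52, 50,
    57, 63, 64, 70, 62, 79, 60, 59, 75, 76, 71, 80, 77], [45, 25, 54, 84, 57, 70, 26, 79, 41, 36,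
    38, 32, 86, 65, 62, 34, 42, 35, 39, 33, 43, 59, 66, 72, 76, 67, 80, 83, 60, 63, 77, 68, 81,
    74, 82, 73, 78], [49, 43, 85, 82, 34, 73, 39, 55, 86, 37, 26, 81, 38, 25, 70, 32, 40, 41, 31,
    35, 60, 64, 58, 78, 62, 77, 59, 68, 79, 80, 74, 83, 72, 71, 69, 76], [60, 24, 79, 46, 84, 85,
    27, 37, 86, 30, 63, 42, 35, 54, 31, 38, 39, 40, 41, 56, 82, 64, 61, 75, 55, 65, 77, 78, 71,
    83, 73, 81, 76, 72, 80], [63, 86, 30, 85, 29, 83, 27, 36, 53, 56, 84, 34, 28, 73, 33, 35, 42,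
    37, 41, 58, 57, 51, 49, 81, 77, 55, 79, 75, 71, 80, 76, 78, 74, 82], [52, 45, 38, 60, 77, 25,
    55, 58, 75, 27, 67, 80, 79, 31, 43, 33, 41, 42, 39, 54, 53, 65, 49, 74, 61, 78, 70, 68, 69,
    73, 72, 81, 83], [76, 32, 31, 43, 56, 24, 84, 37, 26, 28, 41, 46, 34, 38, 42, 40, 71, 65, 67,
    63, 69, 75, 81, 83, 80, 72, 60, 73, 70, 78, 77, 74], [81, 35, 86, 84, 32, 85, 33, 36, 68, 37,
    63, 26, 38, 41, 43, 49, 69, 52, 61, 55, 57, 78, 72, 73, 71, 79, 74, 67, 83, 82, 80], [44, 28,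
    42, 27, 51, 29, 86, 37, 43, 35, 36, 39, 34, 41, 74, 62, 54, 57, 83, 76, 75, 60, 65, 79, 72,
    66, 80, 78, 82, 71], [36, 52, 28, 25, 54, 71, 80, 30, 40, 32, 33, 43, 42, 41, 46, 83, 77, 81,
    57, 67, 59, 69, 58, 73, 68, 76, 70, 78, 82], [58, 85, 74, 25, 33, 26, 42, 47, 34, 38, 35, 40,
    70, 54, 57, 62, 52, 78, 56, 65, 80, 61, 72, 79, 67, 69, 82, 81], [51, 33, 71, 85, 29, 35, 28,
    38, 40, 34, 76, 49, 50, 53, 82, 63, 65, 62, 69, 64, 78, 77, 70, 81, 74, 80, 83], [29, 84, 70,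
    71, 39, 26, 35, 42, 43, 53, 47, 78, 72, 68, 54, 75, 76, 61, 83, 64, 80, 79, 73, 82, 81, 77],
    [42, 28, 31, 67, 86, 40, 35, 41, 79, 62, 70, 52, 71, 59, 56, 66, 64, 83, 63, 69, 82, 72, 80,
    77, 81], [34, 85, 27, 36, 43, 30, 39, 40, 47, 49, 66, 70, 73, 69, 74, 76, 58, 82, 65, 67, 83,
    80, 79, 78], [43, 69, 24, 30, 39, 32, 67, 58, 82, 80, 55, 76, 78, 62, 79, 57, 59, 68, 83, 74,
    81, 75, 77], [24, 38, 41, 33, 40, 66, 50, 75, 81, 70, 60, 72, 53, 56, 83, 59, 64, 78, 82, 77,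
    79, 76], [29, 32, 33, 38, 51, 72, 59, 48, 53, 66, 61, 76, 63, 83, 82, 64, 81, 77, 79, 78, 75],
    [39, 37, 43, 68, 53, 65, 50, 57, 72, 71, 59, 66, 82, 78, 77, 67, 69, 81, 83, 80], [52, 83, 85,
    74, 48, 86, 80, 72, 84, 61, 66, 81, 70, 76, 79, 59, 82, 58, 77, 68, 60, 63, 65, 75, 73, 78],
    [85, 58, 86, 44, 75, 69, 50, 49, 77, 54, 84, 70, 56, 80, 71, 79, 65, 72, 62, 61, 67, 74, 66,
    68, 83, 78, 82], [64, 66, 45, 62, 59, 84, 56, 81, 83, 48, 65, 86, 74, 67, 60, 71, 72, 53, 78,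
    70, 75, 68, 76, 63, 80, 82, 79], [46, 79, 85, 61, 86, 84, 82, 59, 52, 60, 76, 51, 65, 63, 81,
    68, 78, 69, 62, 74, 70, 80, 75, 77], [84, 58, 68, 55, 59, 72, 82, 47, 76, 57, 80, 56, 79, 51,
    64, 73, 75, 81, 62, 65, 78, 71, 77, 83], [50, 85, 64, 78, 62, 86, 48, 63, 69, 61, 80, 54, 83,
    58, 70, 67, 82, 77, 73, 66, 75, 72, 81], [84, 57, 66, 52, 47, 86, 44, 61, 78, 65, 72, 54, 71,
    56, 67, 74, 76, 75, 77, 82, 73, 83, 79, 81], [84, 69, 86, 85, 72, 64, 71, 56, 59, 74, 52, 60,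
    81, 68, 77, 66, 73, 76, 80, 75, 83, 82], [55, 85, 51, 64, 56, 63, 80, 81, 73, 54, 83, 66, 59,
    57, 76, 71, 77, 75, 82, 79, 74, 70, 78], [71, 48, 85, 86, 60, 83, 67, 68, 82, 78, 55, 66, 77,
    62, 73, 63, 80, 65, 64, 79, 72, 76, 81], [80, 53, 86, 78, 72, 51, 83, 77, 60, 73, 81, 65, 67,
    82, 61, 66, 68, 75, 70, 76, 79], [86, 77, 85, 62, 75, 47, 58, 68, 67, 60, 71, 61, 83, 57, 69,
    81, 73, 80, 74, 82, 79], [84, 47, 68, 85, 62, 75, 73, 79, 50, 61, 58, 54, 72, 76, 70, 66, 74,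
    83, 81], [44, 53, 63, 58, 68, 56, 82, 67, 77, 73, 75, 66, 72, 80, 83, 69, 78, 74, 79], [66,
    84, 77, 74, 55, 69, 75, 73, 64, 62, 81, 70, 65, 67, 76, 71, 78, 80, 83], [84, 74, 82, 59, 76,
    75, 64, 71, 68, 78, 72, 58, 79, 67, 62, 65, 69, 81, 73], [85, 69, 72, 63, 58, 66, 79, 81, 77,
    74, 70, 64, 61, 71, 75, 67, 76, 83], [50, 55, 77, 73, 82, 62, 70, 66, 74, 83, 69, 75, 79, 80,
    76, 78, 81, 71], [81, 78, 71, 55, 68, 80, 54, 64, 70, 63, 67, 79, 69, 83, 82, 72, 75], [77,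
    83, 61, 73, 51, 58, 82, 59, 56, 66, 71, 68, 76, 74, 79, 80], [85, 86, 84], [85, 84, 86], [85,
    86, 84], [85, 86, 84], [84, 86], [85, 86, 84], [84, 85, 86], [85, 84, 86], [86, 85], [86, 85],
    [84, 86], [86, 84], [84, 85], [84, 85], [85, 86, 84], [86, 84], [84], [85, 84, 86], [85], [84,
    86], [84, 85], [85, 86], [86], [86], [85], [85], [85], [85], [84], [84], [86], [86]]

theorem isBicolouredTable_fiveColoured87 :
    isBicolouredTable [24, 20, 40, 2, 1] 87 (tableOf 87 fiveColoured87.flatten) = true := by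
  decide +kernel

/-! ### Assembling the orders. -/

theorem theorem9 :
    (∀ w ∈ ({127, 151, 159, 175} : Set ℕ), ExistsExtendedBicoloring 4 w) ∧
    (∀ w ∈ ({103, 111, 127, 135, 151, 159, 175} : Set ℕ), ExistsExtendedBicoloring 5 w) := by
  constructor <;> intro w hw <;> simp only [Set.mem_insert_iff, Set.mem_singleton_iff] at hw
  · rcases hw with rfl | rfl | rfl | rfl
    -- In each case w = 2v + 1 = 4n + 3. The remaining arguments are v = 2n + 1, the oddness of n,
    -- the sum n + 1 of the first two sizes, the sum n of the others, and positivity of all sizes.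
    · exact existsExtendedBicoloring_of_table (n := 31) isBicolouredTable_fourColoured63 rfl
        (by decide) rfl rfl (by decide)
    · exact existsExtendedBicoloring_of_table (n := 37) isBicolouredTable_fourColoured75 rfl
        (by decide) rfl rfl (by decide)
    · exact existsExtendedBicoloring_of_table (n := 39) isBicolouredTable_fourColoured79 rfl
        (by decide) rfl rfl (by decide)
    · exact existsExtendedBicoloring_of_table (n := 43) isBicolouredTable_fourColoured87 rfl
        (by decide) rfl rfl (by decide)
  · rcases hw with rfl | rfl | rfl | rfl | rfl | rfl | rfl
    · exact existsExtendedBicoloring_of_table (n := 25) isBicolouredTable_fiveColoured51 rfl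
        (by decide) rfl rfl (by decide)
    · exact existsExtendedBicoloring_of_table (n := 27) isBicolouredTable_fiveColoured55 rfl
        (by decide) rfl rfl (by decide)
    · exact existsExtendedBicoloring_of_table (n := 31) isBicolouredTable_fiveColoured63 rfl
        (by decide) rfl rfl (by decide)
    · exact existsExtendedBicoloring_of_table (n := 33) isBicolouredTable_fiveColoured67 rfl
        (by decide) rfl rfl (by decide)
    · exact existsExtendedBicoloring_of_table (n := 37) isBicolouredTable_fiveColoured75 rfl
        (by decide) rfl rfl (by decide)
    · exact existsExtendedBicoloring_of_table (n := 39) isBicolouredTable_fiveColoured79 rfl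
        (by decide) rfl rfl (by decide)
    · exact existsExtendedBicoloring_of_table (n := 43) isBicolouredTable_fiveColoured87 rfl
        (by decide) rfl rfl (by decide)
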